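/- Let $\mathfrak B$ be the set of odd positive integers that are sums of two coprime squares, write $e(x)=e^{2\pi i x}$, and for real $\alpha$ and $N$ put $S(\alpha;N)=\sum_{b\in\mathfrak B,\ b\le N}e(b\alpha)$. For every $\varepsilon>0$ there is a constant $C_\varepsilon>0$, depending only on $\varepsilon$, such that the following holds. Let $\alpha=\frac aq+\beta$ be a real number (or a point of $\mathbb R/\mathbb Z$), where $a$ and $q\ge1$ are coprime integers and $q^2|\beta|\le1$. Then, for all real $N>1$ and $R\ge1$, $$\sum_{1\le r\le R}|S(r\alpha;N)|\le C_\varepsilon\,\frac{RN}{\sqrt{\log N}}\left(\frac1{\sqrt q}+\frac{\sqrt q}{\sqrt{RN}}+\frac1{R^{1/3}N^{1/6}}+\frac{R^{1/3}}{N^{1/3}}\right)N^{\varepsilon}.$$ -/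

import Mathlib

namespace OddPrimitive

/-- The set of odd positive integers that are sums of two coprime squares
(equivalently, the odd positive integers without prime factor `≡ 3 mod 4`; it contains `1`). -/
def B : Set ℕ := {n | Odd n ∧ ∃ x y : ℕ, Nat.Coprime x y ∧ n = x ^ 2 + y ^ 2}

/-- The characteristic function of `B`. -/
noncomputable def b : ℕ → ℂ := B.indicator 1

/-- `e(x) = exp(2πix)`. -/
noncomputable def e (x : ℝ) : ℂ := Complex.exp (2 * Real.pi * Complex.I * x)

/-- The trigonometric polynomial `S(α; N) = ∑_{1 ≤ n ≤ N} b(n) e(nα)`; it depends on `α` modulo `1`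
only. -/
noncomputable def S (α N : ℝ) : ℂ := ∑ n ∈ Finset.Icc 1 ⌊N⌋₊, b n * e (n * α)

end OddPrimitive

/-!
An odd number is a sum of two coprime squares iff it is `≡ 1 mod 4` and has no prime factor
`≡ 3 mod 4` (`mem_B_iff`). So `b` is obtained by sieving the progression `1 mod 4` by the primes
`≡ 3 mod 4`, and no parity obstruction arises: a number `≡ 1 mod 4` cannot have exactly one such prime
factor, hence its least one is at most its square root (`sq_le_of_least_prime`). Legendre's formula,
truncated at a level `A` with `N ≤ A ^ 4`, becomes the identity `b_eq_sum_divisors`: divisors `d < A`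
enter with their Möbius weight, and the remaining ones are grouped by the product `m` of their largest
prime factors, stopped as soon as it reaches `A`, which lies in `[A, A ^ 2]`.

The divisors `d < A` give linear sums: the inner sum is geometric with ratio `e (4 r d α)`, and
collecting `4 r d` into one variable, at the cost of a divisor function, leaves
`∑ min (R N / k, 1 / ‖k α‖)` (`sum_progressionSum_le`).

The other terms give bilinear sums over `m` and `l` with `m l ≤ N`. The conditions tying `m` to `l`
(the hyperbola, the residue of `m l`, and that `l` has no prime factor `≡ 3 mod 4` below the least
prime factor of `m`) are comparisons of functions of `m` and of `l`. Reading binary digits, the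
indicator of such a comparison is a combination of products of bounded functions, of logarithmic total
size (`Separable.indicator_lt`), so it suffices to treat coefficients `x m * y l`. For these `r m` is
collected into one variable and Cauchy's inequality is applied (`sum_norm_bilinear_le`).

With `A = max ((N / R) ^ (1 / 3), N ^ (1 / 4))` every term is at most the claimed one
(`exists_level`, `error_terms_le`), and the logarithms and divisor functions are absorbed in `N ^ ε`.
-/

namespace OddPrimitive

open Finset

/-! ### Odd sums of two coprime squares -/

/-- Brahmagupta's identity gives two representations of `p * n`. A common factor of the two
coordinates of either one divides `p`, and if both had the common factor `p` then `p` would divide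
`2 * x` and `2 * y`. -/
lemma exists_coprime_sq_add_sq_mul {p : ℕ} (hp : p.Prime) (hp1 : p % 4 = 1) {x y : ℤ}
    (h : IsCoprime x y) :
    ∃ x' y' : ℤ, IsCoprime x' y' ∧ x' ^ 2 + y' ^ 2 = p * (x ^ 2 + y ^ 2) := by
  have := Fact.mk hp
  obtain ⟨u, v, huv⟩ := Nat.Prime.sq_add_sq (p := p) (by omega)
  have hpI : Prime (p : ℤ) := Nat.prime_iff_prime_int.mp hp
  have huv' : (p : ℤ) = (u : ℤ) ^ 2 + (v : ℤ) ^ 2 := by exact_mod_cast huv.symm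
  obtain ⟨s, t, hst⟩ := h
  have key : ∀ w : ℤ, IsCoprime (x * u - y * w) (x * w + y * u) ∨
      ((p : ℤ) ∣ x * u - y * w ∧ (p : ℤ) ∣ x * w + y * u) ∨ (p : ℤ) ≠ u ^ 2 + w ^ 2 := by
    intro w
    by_cases hw : (p : ℤ) = u ^ 2 + w ^ 2
    swap
    · exact Or.inr (Or.inr hw)
    have hg : gcd (x * u - y * w) (x * w + y * u) ∣ (p : ℤ) := by
      have h1 := gcd_dvd_left (x * u - y * w) (x * w + y * u)
      have h2 := gcd_dvd_right (x * u - y * w) (x * w + y * u)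
      have e : (p : ℤ) = (x * u - y * w) * (s * u - t * w) + (x * w + y * u) * (s * w + t * u) := by
        linear_combination (p : ℤ) * (-hst) + (s * x + t * y) * hw
      rw [e]
      exact dvd_add (Dvd.dvd.mul_right h1 _) (Dvd.dvd.mul_right h2 _)
    rcases hpI.irreducible.dvd_iff.mp hg with h1 | h1
    · left
      exact (gcd_isUnit_iff _ _).mp h1
    · right; left
      exact ⟨h1.dvd.trans (gcd_dvd_left _ _), h1.dvd.trans (gcd_dvd_right _ _)⟩
  rcases key v with h1 | ⟨h1, h2⟩ | h1
  · exact ⟨_, _, h1, by rw [huv']; ring⟩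
  · rcases key (-v) with h3 | ⟨h3, h4⟩ | h3
    · exact ⟨_, _, h3, by rw [huv']; ring⟩
    · exfalso
      have hu : ¬ (p : ℤ) ∣ u := by
        intro hu
        have hv : (p : ℤ) ∣ v := hpI.dvd_of_dvd_pow (n := 2) (by
          have : (v : ℤ) ^ 2 = p - u * u := by rw [huv']; ring
          rw [this]
          exact dvd_sub dvd_rfl (hu.mul_right _))
        have : (p : ℤ) * p ∣ p * 1 := by
          rw [mul_one]; nth_rw 3 [huv']
          rw [sq, sq]
          exact dvd_add (mul_dvd_mul hu hu) (mul_dvd_mul hv hv)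
        have := (mul_dvd_mul_iff_left hpI.ne_zero).mp this
        exact hpI.not_dvd_one this
      have h2' : ¬ (p : ℤ) ∣ 2 := by
        intro h
        have : p ∣ 2 := by exact_mod_cast h
        have := Nat.le_of_dvd (by norm_num) this
        interval_cases p <;> omega
      have hx : (p : ℤ) ∣ x := by
        have : (p : ℤ) ∣ 2 * x * u := by
          have := dvd_add h1 h3
          ring_nf at this ⊢
          exact this
        exact ((hpI.dvd_or_dvd this).resolve_right hu |> hpI.dvd_or_dvd).resolve_left h2'
      have hy : (p : ℤ) ∣ y := by
        have : (p : ℤ) ∣ 2 * y * u := by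
          have := dvd_add h2 h4
          ring_nf at this ⊢
          exact this
        exact ((hpI.dvd_or_dvd this).resolve_right hu |> hpI.dvd_or_dvd).resolve_left h2'
      exact hpI.not_dvd_one (hst ▸ dvd_add (hx.mul_left s) (hy.mul_left t))
    · exact absurd (by rw [huv']; ring) h3
  · exact absurd huv' h1

lemma exists_coprime_sq_add_sq (n : ℕ) (hn : n ≠ 0) (h : ∀ p : ℕ, p.Prime → p ∣ n → p % 4 = 1) :
    ∃ x y : ℤ, IsCoprime x y ∧ x ^ 2 + y ^ 2 = n := by
  induction n using induction_on_primes with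
  | zero => exact absurd rfl hn
  | one => exact ⟨1, 0, isCoprime_one_left, by norm_num⟩
  | prime_mul p a hp ih =>
    obtain ⟨x, y, h1, h2⟩ := ih (right_ne_zero_of_mul hn) fun l hl hd => h l hl (hd.mul_left p)
    obtain ⟨x', y', h1', h2'⟩ := exists_coprime_sq_add_sq_mul hp (h p hp (dvd_mul_right p a)) h1
    exact ⟨x', y', h1', by rw [h2', h2]; norm_num⟩

lemma mem_B_iff (n : ℕ) :
    n ∈ B ↔ n % 4 = 1 ∧ ∀ p : ℕ, p.Prime → p % 4 = 3 → ¬ p ∣ n := by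
  constructor
  · rintro ⟨hodd, x, y, hxy, rfl⟩
    refine ⟨?_, fun p hp hp3 hdvd => ?_⟩
    · have hx : x ^ 2 % 4 = 0 ∨ x ^ 2 % 4 = 1 := by
        have := Nat.mod_lt x (show 0 < 4 by norm_num)
        rw [Nat.pow_mod]; interval_cases x % 4 <;> simp
      have hy : y ^ 2 % 4 = 0 ∨ y ^ 2 % 4 = 1 := by
        have := Nat.mod_lt y (show 0 < 4 by norm_num)
        rw [Nat.pow_mod]; interval_cases y % 4 <;> simp
      rw [Nat.odd_iff] at hodd
      omega
    · have h1 := ZMod.isSquare_neg_one_of_eq_sq_add_sq_of_coprime rfl hxy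
      have h0 : x ^ 2 + y ^ 2 ≠ 0 := by
        rintro h; rw [h] at hodd; simp at hodd
      exact Nat.mod_four_ne_three_of_mem_primeFactors_of_isSquare_neg_one
        (Nat.mem_primeFactors.mpr ⟨hp, hdvd, h0⟩) h1 hp3
  · rintro ⟨h1, h3⟩
    refine ⟨Nat.odd_iff.mpr (by omega), ?_⟩
    obtain ⟨x, y, hxy, h⟩ := exists_coprime_sq_add_sq n (by omega) (fun p hp hd => by
      have h2 : p % 2 = 1 := Nat.odd_iff.mp ((Nat.odd_iff.mpr (by omega : n % 2 = 1)).of_dvd_nat hd)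
      have := h3 p hp
      by_contra h4
      exact this (by omega) hd)
    refine ⟨x.natAbs, y.natAbs, Int.isCoprime_iff_gcd_eq_one.mp hxy, ?_⟩
    zify
    rw [sq_abs, sq_abs, h]

/-! ### The sieve identity -/

lemma mod_four_eq_one_of_forall_prime (k : ℕ) (hk : k ≠ 0)
    (h : ∀ p : ℕ, p.Prime → p ∣ k → p % 4 = 1) : k % 4 = 1 := by
  induction k using induction_on_primes with
  | zero => exact absurd rfl hk
  | one => rfl
  | prime_mul p a hp ih =>
    have h1 := ih (right_ne_zero_of_mul hk) fun l hl hd => h l hl (hd.mul_left p)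
    have h2 := h p hp (dvd_mul_right p a)
    rw [Nat.mul_mod, h1, h2]

/-- A number `≡ 1 mod 4` cannot have exactly one prime factor `≡ 3 mod 4` (with multiplicity), so
the least one is at most the square root. -/
lemma sq_le_of_least_prime {n p : ℕ} (hn : n % 4 = 1) (hp3 : p % 4 = 3)
    (hpn : p ∣ n) (hmin : ∀ l : ℕ, l.Prime → l % 4 = 3 → l ∣ n → p ≤ l) : p ^ 2 ≤ n := by
  obtain ⟨k, rfl⟩ := hpn
  have hk : k % 4 = 3 := by
    rw [Nat.mul_mod, hp3] at hn
    have := Nat.mod_lt k (show 0 < 4 by norm_num)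
    interval_cases k % 4 <;> simp_all
  have : ∃ l : ℕ, l.Prime ∧ l % 4 = 3 ∧ l ∣ k := by
    by_contra! hcon
    have := mod_four_eq_one_of_forall_prime k (by omega) fun l hl hd => by
      have h2 : l % 2 = 1 := Nat.odd_iff.mp ((Nat.odd_iff.mpr (by omega : k % 2 = 1)).of_dvd_nat hd)
      by_contra h4
      exact hcon l hl (by omega) hd
    omega
  obtain ⟨l, hl, hl3, hlk⟩ := this
  have h1 := hmin l hl hl3 (hlk.mul_left p)
  have h2 := Nat.le_of_dvd (by omega) hlk
  rw [sq]
  exact Nat.mul_le_mul_left p (h1.trans h2)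

/-- `l` has no prime factor `≡ 3 mod 4` below `t`. -/
def Sifted (l t : ℕ) : Prop := ∀ p < t, p.Prime → p % 4 = 3 → ¬ p ∣ l

open Classical in
/-- The Möbius function restricted to products of primes `≡ 3 mod 4`. -/
noncomputable def sieveWeight (d : ℕ) : ℂ :=
  if ∀ p : ℕ, p.Prime → p ∣ d → p % 4 = 3 then (ArithmeticFunction.moebius d : ℂ) else 0

/-- The coefficients of the bilinear part. They are supported on products `m ∈ [A, A ^ 2]` of distinct
primes `≡ 3 mod 4` that reach `A` only with their least prime factor, when the primes are multiplied in
decreasing order. -/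
noncomputable def bilinearWeight (A : ℝ) (m : ℕ) : ℂ :=
  if A ≤ m ∧ (m : ℝ) ≤ A ^ 2 ∧ (m : ℝ) < A * m.minFac then sieveWeight m else 0

lemma norm_sieveWeight_le (d : ℕ) : ‖sieveWeight d‖ ≤ 1 := by
  unfold sieveWeight
  split_ifs
  · rw [Complex.norm_intCast]
    exact_mod_cast ArithmeticFunction.abs_moebius_le_one
  · simp

lemma norm_bilinearWeight_le (A : ℝ) (m : ℕ) : ‖bilinearWeight A m‖ ≤ 1 := by
  unfold bilinearWeight
  split_ifs
  · exact norm_sieveWeight_le m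
  · simp

lemma squarefree_of_sieveWeight_ne_zero {d : ℕ} (h : sieveWeight d ≠ 0) : Squarefree d := by
  unfold sieveWeight at h
  split_ifs at h
  · exact ArithmeticFunction.moebius_ne_zero_iff_squarefree.mp (by exact_mod_cast h)
  · exact absurd rfl h

lemma prime_mod_of_sieveWeight_ne_zero {d : ℕ} (h : sieveWeight d ≠ 0) :
    ∀ p : ℕ, p.Prime → p ∣ d → p % 4 = 3 := by
  unfold sieveWeight at h
  split_ifs at h with h1
  · exact h1
  · exact absurd rfl h

lemma sieveWeight_mul_prime {d p : ℕ} (hp : p.Prime) (hp3 : p % 4 = 3) (hpd : ¬ p ∣ d) :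
    sieveWeight (d * p) = - sieveWeight d := by
  have h : (∀ l : ℕ, l.Prime → l ∣ d * p → l % 4 = 3) ↔ ∀ l : ℕ, l.Prime → l ∣ d → l % 4 = 3 := by
    refine ⟨fun h l hl hd => h l hl (hd.mul_right p), fun h l hl hd => ?_⟩
    rcases hl.dvd_mul.mp hd with h1 | h1
    · exact h l hl h1
    · rwa [(Nat.prime_dvd_prime_iff_eq hl hp).mp h1]
  unfold sieveWeight
  by_cases hc : ∀ l : ℕ, l.Prime → l ∣ d → l % 4 = 3
  · rw [if_pos hc, if_pos (h.mpr hc), ArithmeticFunction.isMultiplicative_moebius.map_mul_of_coprime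
      ((Nat.Prime.coprime_iff_not_dvd hp).mpr hpd).symm, ArithmeticFunction.moebius_apply_prime hp]
    push_cast
    ring
  · rw [if_neg hc, if_neg (mt h.mp hc), neg_zero]

open Classical in
/-- The contribution of the divisor `d` of `n` to the identity `b_eq_sum_divisors`. -/
noncomputable def divisorTerm (A : ℝ) (n d : ℕ) : ℂ :=
  sieveWeight d * (if (d : ℝ) < A then 1 else 0)
    + bilinearWeight A d * (if Sifted (n / d) d.minFac then 1 else 0)

lemma sieveWeight_ne_zero_of_divisorTerm_ne_zero {A : ℝ} {n d : ℕ} (h : divisorTerm A n d ≠ 0) :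
    sieveWeight d ≠ 0 := by
  contrapose! h
  simp [divisorTerm, bilinearWeight, h]

open Classical in
/-- The cancellation behind the sieve identity: divisors are paired by inserting the least prime
factor `p ≡ 3 mod 4` of `n`. -/
lemma divisorTerm_add_mul_prime {A : ℝ} (hA : 1 < A) {n p d : ℕ} (hnA : (n : ℝ) ≤ A ^ 4)
    (hn : n % 4 = 1) (hp : p.Prime) (hp3 : p % 4 = 3) (hpn : p ∣ n)
    (hmin : ∀ l : ℕ, l.Prime → l % 4 = 3 → l ∣ n → p ≤ l) (hd : d ∣ n) (hpd : ¬ p ∣ d) :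
    divisorTerm A n d + divisorTerm A n (d * p) = 0 := by
  by_cases h0 : sieveWeight d = 0
  · have h1 : sieveWeight (d * p) = 0 := by rw [sieveWeight_mul_prime hp hp3 hpd, h0, neg_zero]
    simp [divisorTerm, bilinearWeight, h0, h1]
  have hd3 := prime_mod_of_sieveWeight_ne_zero h0
  have hd0 : d ≠ 0 := by rintro rfl; simp at hpd
  have hlt : ∀ l : ℕ, l.Prime → l ∣ d → p < l := fun l hl hld =>
    lt_of_le_of_ne (hmin l hl (hd3 l hl hld) (hld.trans hd)) (by rintro rfl; exact hpd hld)
  have hcop : Nat.Coprime d p := ((Nat.Prime.coprime_iff_not_dvd hp).mpr hpd).symm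
  have hdpn : d * p ∣ n := hcop.mul_dvd_of_dvd_of_dvd hd hpn
  -- `p` divides `n / d` and lies below the least prime factor of `d`.
  have hfirst : bilinearWeight A d * (if Sifted (n / d) d.minFac then (1 : ℂ) else 0) = 0 := by
    by_cases hd1 : d = 1
    · subst hd1
      have : ¬ A ≤ 1 := not_le.mpr hA
      simp [bilinearWeight, this]
    · rw [if_neg, mul_zero]
      intro hs
      refine hs p (hlt _ (Nat.minFac_prime hd1) (Nat.minFac_dvd d)) hp hp3 ?_
      exact (Nat.dvd_div_iff_mul_dvd hd).mpr hdpn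
  have hmf : (d * p).minFac = p := by
    refine le_antisymm (Nat.minFac_le_of_dvd hp.two_le (dvd_mul_left p d)) ?_
    have hne : d * p ≠ 1 := fun h => hp.one_lt.ne' (Nat.eq_one_of_mul_eq_one_left h)
    rcases (Nat.minFac_prime hne).dvd_mul.mp (Nat.minFac_dvd _) with h1 | h1
    · exact (hlt _ (Nat.minFac_prime hne) h1).le
    · exact ((Nat.prime_dvd_prime_iff_eq (Nat.minFac_prime hne) hp).mp h1).ge
  have hsift : Sifted (n / (d * p)) p := fun l hl hlp hl3 hln =>
    absurd (hmin l hlp hl3 (hln.trans (Nat.div_dvd_of_dvd hdpn))) (by omega)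
  have hp0 : (0 : ℝ) < p := by exact_mod_cast hp.pos
  have hp1 : (1 : ℝ) ≤ p := by exact_mod_cast hp.one_le
  have hd1 : (1 : ℝ) ≤ d := by exact_mod_cast Nat.pos_of_ne_zero hd0
  -- If `p > A`, then every prime factor of `d < A` would exceed `p > A`, so `d = 1`, and `p ≤ √n`.
  have hle : (d : ℝ) < A → (d : ℝ) * p ≤ A ^ 2 := by
    intro hdA
    rcases le_or_gt (p : ℝ) A with h | h
    · nlinarith
    · have hd1' : d = 1 := by
        by_contra hd1'
        have h1 := hlt _ (Nat.minFac_prime hd1') (Nat.minFac_dvd d)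
        have h2 := Nat.minFac_le (Nat.pos_of_ne_zero hd0)
        have h3 : (p : ℝ) < d := by exact_mod_cast h1.trans_le h2
        linarith
      have h2 : ((p : ℝ)) ^ 2 ≤ n := by exact_mod_cast sq_le_of_least_prime hn hp3 hpn hmin
      rw [hd1', Nat.cast_one, one_mul]
      exact (pow_le_pow_iff_left₀ hp0.le (by positivity) two_ne_zero).mp
        (by rw [← pow_mul]; exact h2.trans hnA)
  unfold divisorTerm
  rw [hfirst, hmf, if_pos hsift]
  unfold bilinearWeight
  rw [hmf, sieveWeight_mul_prime hp hp3 hpd]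
  push_cast
  by_cases h1 : (d : ℝ) < A
  · have h2 : (d : ℝ) * p < A * p := by gcongr
    by_cases h3 : (d : ℝ) * p < A
    · simp [h1, h3]
    · simp [h1, h2, h3, not_lt.mp h3, hle h1]
  · have h2 : ¬ (d : ℝ) * p < A * p := by
      rw [not_lt] at h1 ⊢; gcongr
    have h3 : ¬ (d : ℝ) * p < A := by
      rw [not_lt] at h1 ⊢; nlinarith
    simp [h1, h2, h3]

/-- Legendre's sieve by the primes `≡ 3 mod 4`, truncated at level `A`. The divisors below `A` remain
as they are; the others are grouped by the product `m ∈ [A, A ^ 2]` of their largest prime factors. -/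
lemma b_eq_sum_divisors {A : ℝ} (hA : 1 < A) {n : ℕ} (hnA : (n : ℝ) ≤ A ^ 4) (hn : n % 4 = 1) :
    b n = ∑ d ∈ n.divisors, divisorTerm A n d := by
  classical
  have hn0 : n ≠ 0 := by omega
  by_cases hB : ∀ p : ℕ, p.Prime → p % 4 = 3 → ¬ p ∣ n
  · have hmem : n ∈ B := (mem_B_iff n).mpr ⟨hn, hB⟩
    rw [b, Set.indicator_of_mem hmem, Finset.sum_eq_single_of_mem 1 (by simp [hn0])]
    · have : ¬ A ≤ 1 := not_le.mpr hA
      simp [divisorTerm, bilinearWeight, sieveWeight, hA, this]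
      exact fun h => absurd h Nat.not_prime_one
    · intro d hd hd1
      by_contra h
      have h3 := prime_mod_of_sieveWeight_ne_zero (sieveWeight_ne_zero_of_divisorTerm_ne_zero h)
      exact hB _ (Nat.minFac_prime hd1) (h3 _ (Nat.minFac_prime hd1) (Nat.minFac_dvd d))
        ((Nat.minFac_dvd d).trans (Nat.dvd_of_mem_divisors hd))
  · have hex : ∃ p : ℕ, p.Prime ∧ p % 4 = 3 ∧ p ∣ n := by push Not at hB; exact hB
    obtain ⟨hp, hp3, hpn⟩ := Nat.find_spec hex
    have hmin : ∀ l : ℕ, l.Prime → l % 4 = 3 → l ∣ n → Nat.find hex ≤ l := fun l h1 h2 h3 =>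
      Nat.find_min' hex ⟨h1, h2, h3⟩
    generalize Nat.find hex = p at hp hp3 hpn hmin
    have hmem : n ∉ B := fun h => ((mem_B_iff n).mp h).2 p hp hp3 hpn
    rw [b, Set.indicator_of_notMem hmem]
    -- On squarefree divisors, inserting or removing `p` is an involution.
    have hfil : ∑ d ∈ n.divisors, divisorTerm A n d
        = ∑ d ∈ n.divisors.filter Squarefree, divisorTerm A n d := by
      rw [Finset.sum_filter_of_ne]
      intro d _ h
      exact squarefree_of_sieveWeight_ne_zero (sieveWeight_ne_zero_of_divisorTerm_ne_zero h)
    rw [hfil]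
    symm
    have hsq : ∀ d : ℕ, Squarefree d → p ∣ d → ¬ p ∣ d / p := by
      intro d hd hpd h
      have h1 : p * p ∣ d := (Nat.dvd_div_iff_mul_dvd hpd).mp h
      exact hp.one_lt.ne' (Nat.isUnit_iff.mp (hd p h1))
    refine Finset.sum_involution (fun d _ => if p ∣ d then d / p else d * p) ?_ ?_ ?_ ?_
    · intro d hd
      simp only [mem_filter, Nat.mem_divisors] at hd
      split_ifs with h
      · have h1 := divisorTerm_add_mul_prime hA hnA hn hp hp3 hpn hmin
          ((Nat.div_dvd_of_dvd h).trans hd.1.1) (hsq d hd.2 h)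
        rw [Nat.div_mul_cancel h] at h1
        rw [add_comm]; exact h1
      · exact divisorTerm_add_mul_prime hA hnA hn hp hp3 hpn hmin hd.1.1 h
    · intro d hd _
      simp only [mem_filter, Nat.mem_divisors] at hd
      have hd0 : 0 < d := Nat.pos_of_ne_zero (by rintro rfl; exact hd.1.2 (zero_dvd_iff.mp hd.1.1))
      split_ifs with h
      · exact (Nat.div_lt_self hd0 hp.one_lt).ne
      · intro h1
        exact h ⟨d, by rw [mul_comm]; exact h1.symm⟩
    · intro d hd
      simp only [mem_filter, Nat.mem_divisors] at hd ⊢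
      split_ifs with h
      · exact ⟨⟨(Nat.div_dvd_of_dvd h).trans hd.1.1, hn0⟩,
          hd.2.squarefree_of_dvd (Nat.div_dvd_of_dvd h)⟩
      · have hcop : Nat.Coprime d p := ((Nat.Prime.coprime_iff_not_dvd hp).mpr h).symm
        exact ⟨⟨hcop.mul_dvd_of_dvd_of_dvd hd.1.1 hpn, hn0⟩,
          (Nat.squarefree_mul hcop).mpr ⟨hd.2, hp.squarefree⟩⟩
    · intro d hd
      simp only [mem_filter, Nat.mem_divisors] at hd
      by_cases h : p ∣ d
      · simp only [h, if_true]
        rw [if_neg (hsq d hd.2 h), Nat.div_mul_cancel h]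
      · simp [h, hp.pos]

/-! ### Geometric sums and distances to the nearest integer -/

/-- The distance from `x` to the nearest integer. -/
noncomputable def distToInt (x : ℝ) : ℝ := |x - round x|

lemma distToInt_nonneg (x : ℝ) : 0 ≤ distToInt x := abs_nonneg _

lemma e_add (x y : ℝ) : e (x + y) = e x * e y := by
  unfold e; rw [← Complex.exp_add]; congr 1; push_cast; ring

lemma norm_e (x : ℝ) : ‖e x‖ = 1 := by
  unfold e
  rw [show (2 * Real.pi * Complex.I * x : ℂ) = ((2 * Real.pi * x : ℝ) : ℂ) * Complex.I by
    push_cast; ring]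
  exact Complex.norm_exp_ofReal_mul_I _

lemma e_intCast (n : ℤ) : e n = 1 := by
  unfold e
  rw [show (2 * Real.pi * Complex.I * ((n : ℝ) : ℂ) : ℂ) = n * (2 * Real.pi * Complex.I) by
    push_cast; ring]
  exact Complex.exp_int_mul_two_pi_mul_I n

lemma e_natCast_mul (n : ℕ) (x : ℝ) : e (n * x) = e x ^ n := by
  unfold e; rw [← Complex.exp_nat_mul]; congr 1; push_cast; ring

lemma conj_e (x : ℝ) : (starRingEnd ℂ) (e x) = e (-x) := by
  unfold e
  rw [← Complex.exp_conj]
  simp [Complex.conj_ofNat]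

lemma four_mul_distToInt_le (x : ℝ) : 4 * distToInt x ≤ ‖e x - 1‖ := by
  have h1 : e x = e (x - round x) := by
    have := e_add (x - round x) (round x : ℤ)
    rw [e_intCast, mul_one, sub_add_cancel] at this
    exact this
  rw [h1, distToInt]
  have hy := abs_sub_round x
  generalize x - round x = y at hy
  have h2 : e y = Complex.exp (Complex.I * ((2 * Real.pi * y : ℝ) : ℂ)) := by
    unfold e; congr 1; push_cast; ring
  rw [h2, Complex.norm_exp_I_mul_ofReal_sub_one, Real.norm_eq_abs, abs_mul,
    show 2 * Real.pi * y / 2 = Real.pi * y by ring]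
  have hpi := Real.pi_pos
  have h3 := Real.mul_abs_le_abs_sin (x := Real.pi * y) (by
    rw [abs_mul, abs_of_pos hpi]; nlinarith)
  rw [abs_mul, abs_of_pos hpi] at h3
  have h4 : 2 / Real.pi * (Real.pi * |y|) = 2 * |y| := by field_simp
  rw [h4] at h3
  rw [abs_two]
  linarith

/-- A geometric sum is at most `1 / (2 * distToInt θ)`; the product form needs no convention for
integral `θ`. -/
lemma norm_sum_e_mul_distToInt_le (K : ℕ) (φ θ : ℝ) :
    ‖∑ k ∈ range K, e (φ + k * θ)‖ * distToInt θ ≤ 1 := by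
  have h1 : ∑ k ∈ range K, e (φ + k * θ) = e φ * ∑ k ∈ range K, e θ ^ k := by
    rw [mul_sum]
    exact sum_congr rfl fun k _ => by rw [e_add, e_natCast_mul]
  have h2 : ‖∑ k ∈ range K, e θ ^ k‖ * ‖e θ - 1‖ ≤ 2 := by
    rw [← norm_mul, geom_sum_mul]
    refine (norm_sub_le _ _).trans ?_
    rw [norm_pow, norm_e]; norm_num
  rw [h1, norm_mul, norm_e, one_mul]
  have h3 := four_mul_distToInt_le θ
  have h4 := norm_nonneg (∑ k ∈ range K, e θ ^ k)
  nlinarith [mul_le_mul_of_nonneg_left h3 h4]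

lemma norm_sum_e_le (K : ℕ) (f : ℕ → ℝ) : ‖∑ k ∈ range K, e (f k)‖ ≤ K := by
  refine (norm_sum_le _ _).trans ?_
  simp [norm_e]

/-- Among `q` consecutive multiples of `α ≈ a / q`, at most three have their fractional part in a given
interval `[t / q, (t + 1) / q)`. -/
lemma card_fiber_le_three {α β : ℝ} {a : ℤ} {q : ℕ} (hq : 1 ≤ q) (hcop : IsCoprime a (q : ℤ))
    (hα : α = (a : ℝ) / q + β) (hβ : (q : ℝ) ^ 2 * |β| ≤ 1) (h₀ : ℤ) (t : ℕ) :
    #{i ∈ range q | ⌊(q : ℝ) * Int.fract (((h₀ + (i : ℕ) : ℤ) : ℝ) * α)⌋₊ = t} ≤ 3 := by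
  set s := {i ∈ range q | ⌊(q : ℝ) * Int.fract (((h₀ + (i : ℕ) : ℤ) : ℝ) * α)⌋₊ = t} with hs
  rcases s.eq_empty_or_nonempty with h | ⟨i₀, hi₀⟩
  · rw [h]; simp
  have hq0 : (0 : ℝ) < q := by exact_mod_cast hq
  -- Modulo one, `(i - i₀) α` is less than `1 / q` in absolute value, and `|(i - i₀) β| < 1 / q`: hence
  -- `(i - i₀) a` is `-1`, `0` or `1` modulo `q`.
  have key : ∀ i ∈ s, (((i : ℤ) : ZMod q) * a - (i₀ : ℤ) * a) ∈ ({-1, 0, 1} : Finset (ZMod q)) := by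
    intro i hi
    simp only [hs, mem_filter, mem_range] at hi hi₀
    have hf : |Int.fract (((h₀ + i : ℤ) : ℝ) * α) - Int.fract (((h₀ + i₀ : ℤ) : ℝ) * α)| < 1 / q := by
      have hnn : ∀ x : ℝ, 0 ≤ (q : ℝ) * Int.fract x := fun x => mul_nonneg hq0.le (Int.fract_nonneg x)
      have h1 := Nat.floor_le (hnn (((h₀ + i : ℤ) : ℝ) * α))
      have h2 := Nat.lt_floor_add_one ((q : ℝ) * Int.fract (((h₀ + i : ℤ) : ℝ) * α))
      have h3 := Nat.floor_le (hnn (((h₀ + i₀ : ℤ) : ℝ) * α))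
      have h4 := Nat.lt_floor_add_one ((q : ℝ) * Int.fract (((h₀ + i₀ : ℤ) : ℝ) * α))
      rw [hi.2] at h1 h2
      rw [hi₀.2] at h3 h4
      rw [abs_lt, lt_div_iff₀ hq0, ← neg_div, div_lt_iff₀ hq0]
      constructor <;> linarith
    set m : ℤ := ⌊((h₀ + i : ℤ) : ℝ) * α⌋ - ⌊((h₀ + i₀ : ℤ) : ℝ) * α⌋ with hm
    set D : ℤ := ((i : ℤ) - i₀) with hD
    have hfe : Int.fract (((h₀ + i : ℤ) : ℝ) * α) - Int.fract (((h₀ + i₀ : ℤ) : ℝ) * α)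
        = D * α - m := by
      rw [Int.fract, Int.fract, hm, hD]; push_cast; ring
    rw [hfe] at hf
    have hDabs : |(D : ℝ)| ≤ q - 1 := by
      have : |D| ≤ q - 1 := by rw [hD, abs_le]; omega
      have h2 : ((|D| : ℤ) : ℝ) ≤ ((q - 1 : ℤ) : ℝ) := by exact_mod_cast this
      push_cast at h2; exact h2
    have hint : |(D * a - m * q : ℤ)| < 2 := by
      have e1 : ((D * a - m * q : ℤ) : ℝ) = q * (D * α - m) - q * (D * β) := by
        rw [hα]; push_cast; field_simp; ring
      have h1 : |(q : ℝ) * (D * α - m)| < 1 := by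
        rw [abs_mul, abs_of_pos hq0]
        calc (q : ℝ) * |D * α - m| < q * (1 / q) := by gcongr
          _ = 1 := by field_simp
      have h2 : |(q : ℝ) * (D * β)| ≤ 1 := by
        rw [abs_mul, abs_of_pos hq0, abs_mul]
        have : (q : ℝ) * (|(D : ℝ)| * |β|) ≤ q * (q * |β|) := by
          gcongr; linarith
        nlinarith
      have h3 : |((D * a - m * q : ℤ) : ℝ)| < 2 := by
        rw [e1]
        exact (abs_sub _ _).trans_lt (by linarith)
      exact_mod_cast h3
    have hz : (((i : ℤ) : ZMod q) * a - (i₀ : ℤ) * a) = ((D * a - m * q : ℤ) : ZMod q) := by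
      rw [hD]; push_cast; simp; ring
    rw [hz]
    generalize D * a - m * q = w at hint
    rw [abs_lt] at hint
    have : w = -1 ∨ w = 0 ∨ w = 1 := by omega
    rcases this with rfl | rfl | rfl <;> simp
  refine (card_le_card_of_injOn (fun i : ℕ => (((i : ℤ) : ZMod q) * a - (i₀ : ℤ) * a)) key ?_).trans
    card_le_three
  intro i hi j hj hij
  simp only [hs, coe_filter, mem_range, Set.mem_ofPred_eq] at hi hj
  have h1 : (((i - j) * a : ℤ) : ZMod q) = 0 := by
    push_cast
    have : ((i : ℤ) : ZMod q) * a = ((j : ℤ) : ZMod q) * a := sub_left_injective hij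
    push_cast at this
    linear_combination this
  rw [ZMod.intCast_zmod_eq_zero_iff_dvd] at h1
  have h2 : (q : ℤ) ∣ (i : ℤ) - j := hcop.symm.dvd_of_dvd_mul_right h1
  have h3 := Int.eq_zero_of_abs_lt_dvd h2 (by rw [abs_lt]; omega)
  omega

lemma sum_inv_range_le (q : ℕ) (hq : 1 ≤ q) : ∑ t ∈ range q, (1 / (t : ℝ)) ≤ 1 + Real.log q := by
  obtain ⟨k, rfl⟩ : ∃ k, q = k + 1 := ⟨q - 1, by omega⟩
  rw [sum_range_succ']
  have h := harmonic_le_one_add_log k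
  have h2 : ((harmonic k : ℚ) : ℝ) = ∑ t ∈ range k, 1 / ((t + 1 : ℕ) : ℝ) := by
    rw [harmonic]; push_cast; simp
  rw [h2] at h
  rcases Nat.eq_zero_or_pos k with rfl | hk
  · simp
  have h3 : Real.log k ≤ Real.log ((k + 1 : ℕ) : ℝ) :=
    Real.log_le_log (by exact_mod_cast hk) (by push_cast; linarith)
  simp only [Nat.cast_zero, div_zero, add_zero]
  linarith

/-- The standard estimate for `∑ min (X, 1 / ‖h α‖)` over `q` consecutive `h`. The hypothesis
`F i * ‖h α‖ ≤ 1` stands for `F i ≤ 1 / ‖h α‖`, so that `‖h α‖ = 0` imposes nothing. -/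
lemma sum_block_le {α β : ℝ} {a : ℤ} {q : ℕ} (hq : 1 ≤ q) (hcop : IsCoprime a (q : ℤ))
    (hα : α = (a : ℝ) / q + β) (hβ : (q : ℝ) ^ 2 * |β| ≤ 1) (h₀ : ℤ) {X : ℝ} (hX : 0 ≤ X)
    (F : ℕ → ℝ) (hF : ∀ i < q, F i ≤ X)
    (hF' : ∀ i < q, F i * distToInt (((h₀ + i : ℤ) : ℝ) * α) ≤ 1) :
    ∑ i ∈ range q, F i ≤ 6 * (X + q * (1 + Real.log q)) := by
  have hq0 : (0 : ℝ) < q := by exact_mod_cast hq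
  set T : ℕ → ℕ := fun i => ⌊(q : ℝ) * Int.fract (((h₀ + i : ℤ) : ℝ) * α)⌋₊ with hT
  -- The bound for a term with fractional part in `[t / q, (t + 1) / q)`. The end intervals `t = 0` and
  -- `t = q - 1` carry `X`; there `1 / 0 = 0` makes one of the last two terms vanish.
  set G : ℕ → ℝ := fun t => (if t = 0 then X else 0) + (if t = q - 1 then X else 0)
    + q * (1 / (t : ℝ)) + q * (1 / ((q - 1 - t : ℕ) : ℝ)) with hG
  have hG0 : ∀ t, 0 ≤ G t := by
    intro t
    simp only [hG]
    have h1 : 0 ≤ (if t = 0 then X else 0) := by split_ifs <;> simp [hX]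
    have h2 : 0 ≤ (if t = q - 1 then X else 0) := by split_ifs <;> simp [hX]
    positivity
  have hTq : ∀ i, T i < q := by
    intro i
    rw [hT, Nat.floor_lt (mul_nonneg hq0.le (Int.fract_nonneg _))]
    have := Int.fract_lt_one (((h₀ + i : ℤ) : ℝ) * α)
    nlinarith
  have hFG : ∀ i ∈ range q, F i ≤ G (T i) := by
    intro i hi
    rw [mem_range] at hi
    have hTi := hTq i
    have hX0 : ∀ p : Prop, ∀ [Decidable p], (0 : ℝ) ≤ if p then X else 0 := by
      intro p _; split_ifs <;> simp [hX]
    have hr1 : (0 : ℝ) ≤ q * (1 / ((T i : ℕ) : ℝ)) := by positivity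
    have hr2 : (0 : ℝ) ≤ q * (1 / ((q - 1 - T i : ℕ) : ℝ)) := by positivity
    by_cases h0 : T i = 0
    · have := hF i hi
      have h2 := hX0 (T i = q - 1)
      simp only [hG]
      rw [if_pos h0]
      linarith
    by_cases h1 : T i = q - 1
    · have := hF i hi
      have h2 := hX0 (T i = 0)
      simp only [hG]
      rw [if_pos h1]
      linarith
    simp only [hG]
    rw [if_neg h0, if_neg h1, zero_add, zero_add]
    rcases le_or_gt (F i) 0 with hneg | hpos
    · linarith
    have hd := hF' i hi
    have hfl := Nat.floor_le (mul_nonneg hq0.le (Int.fract_nonneg (((h₀ + i : ℤ) : ℝ) * α)))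
    have hfl2 := Nat.lt_floor_add_one ((q : ℝ) * Int.fract (((h₀ + i : ℤ) : ℝ) * α))
    rw [distToInt, abs_sub_round_eq_min] at hd
    change ((T i : ℕ) : ℝ) ≤ _ at hfl
    change _ < ((T i : ℕ) : ℝ) + 1 at hfl2
    have hTpos : (0 : ℝ) < T i := by exact_mod_cast Nat.pos_of_ne_zero h0
    have hSpos : (0 : ℝ) < ((q - 1 - T i : ℕ) : ℝ) := by
      have : 0 < q - 1 - T i := by omega
      exact_mod_cast this
    have hS : ((q - 1 - T i : ℕ) : ℝ) = q - 1 - T i := by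
      rw [Nat.cast_sub (by omega), Nat.cast_sub hq]; simp
    rcases min_choice (Int.fract (((h₀ + i : ℤ) : ℝ) * α)) (1 - Int.fract (((h₀ + i : ℤ) : ℝ) * α))
      with hmin | hmin
    · rw [hmin] at hd
      have : F i ≤ q * (1 / ((T i : ℕ) : ℝ)) := by
        rw [mul_one_div, le_div_iff₀ hTpos]
        nlinarith
      linarith
    · rw [hmin] at hd
      have : F i ≤ q * (1 / ((q - 1 - T i : ℕ) : ℝ)) := by
        rw [mul_one_div, le_div_iff₀ hSpos, hS]
        nlinarith
      linarith
  calc ∑ i ∈ range q, F i ≤ ∑ i ∈ range q, G (T i) := sum_le_sum hFG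
    _ = ∑ t ∈ range q, ∑ i ∈ range q with T i = t, G (T i) :=
        (sum_fiberwise_of_maps_to (fun i _ => mem_range.mpr (hTq i)) _).symm
    _ ≤ ∑ t ∈ range q, 3 * G t := by
        refine sum_le_sum fun t _ => ?_
        rw [sum_congr rfl (g := fun _ => G t) (fun i hi => by rw [(mem_filter.mp hi).2]), sum_const,
          nsmul_eq_mul]
        have := card_fiber_le_three hq hcop hα hβ h₀ t
        exact mul_le_mul_of_nonneg_right (by exact_mod_cast this) (hG0 t)
    _ = 3 * (∑ t ∈ range q, (if t = 0 then X else 0) + ∑ t ∈ range q, (if t = q - 1 then X else 0)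
          + q * ∑ t ∈ range q, (1 / (t : ℝ)) + q * ∑ t ∈ range q, (1 / (t : ℝ))) := by
        rw [← mul_sum, sum_add_distrib, sum_add_distrib, sum_add_distrib, ← mul_sum, ← mul_sum,
          sum_range_reflect (fun t => (1 / (t : ℝ))) q]
    _ ≤ 6 * (X + q * (1 + Real.log q)) := by
        have h1 := sum_inv_range_le q hq
        have h2 : ∑ t ∈ range q, (if t = 0 then X else 0) = X := by
          rw [sum_ite_eq' (range q) 0 (fun _ => X), if_pos (by simp; omega)]
        have h3 : ∑ t ∈ range q, (if t = q - 1 then X else 0) = X := by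
          rw [sum_ite_eq' (range q) (q - 1) (fun _ => X), if_pos (by simp; omega)]
        rw [h2, h3]
        nlinarith [mul_le_mul_of_nonneg_left h1 hq0.le]

lemma sum_range_mul_le (q J : ℕ) (F W : ℕ → ℝ)
    (h : ∀ j < J, ∑ i ∈ range q, F (j * q + i) ≤ W j) :
    ∑ k ∈ range (J * q), F k ≤ ∑ j ∈ range J, W j := by
  induction J with
  | zero => simp
  | succ J ih =>
    rw [add_mul, one_mul, sum_range_add, sum_range_succ]
    exact add_le_add (ih fun j hj => h j (by omega)) (h J (by omega))

/-- The standard estimate for `∑ min (X, 1 / ‖h α‖)` over `L` consecutive `h`. -/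
lemma sum_interval_le {α β : ℝ} {a : ℤ} {q : ℕ} (hq : 1 ≤ q) (hcop : IsCoprime a (q : ℤ))
    (hα : α = (a : ℝ) / q + β) (hβ : (q : ℝ) ^ 2 * |β| ≤ 1) (h₀ : ℤ) {X : ℝ} (hX : 0 ≤ X) (L : ℕ)
    (F : ℕ → ℝ) (hF0 : ∀ i, 0 ≤ F i) (hF : ∀ i, F i ≤ X)
    (hF' : ∀ i, F i * distToInt (((h₀ + i : ℤ) : ℝ) * α) ≤ 1) :
    ∑ i ∈ range L, F i ≤ ((L : ℝ) / q + 1) * (6 * (X + q * (1 + Real.log q))) := by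
  have hq0 : (0 : ℝ) < q := by exact_mod_cast hq
  have hL : L ≤ (L / q + 1) * q := by
    have := Nat.lt_div_mul_add (a := L) (b := q) (by omega)
    rw [add_mul, one_mul]; omega
  have hlog : 0 ≤ Real.log q := Real.log_nonneg (by exact_mod_cast hq)
  calc ∑ i ∈ range L, F i ≤ ∑ i ∈ range ((L / q + 1) * q), F i :=
        sum_le_sum_of_subset_of_nonneg (range_subset_range.mpr hL) fun i _ _ => hF0 i
    _ ≤ ∑ _j ∈ range (L / q + 1), 6 * (X + q * (1 + Real.log q)) := by
        refine sum_range_mul_le q _ F _ fun j _ => ?_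
        refine sum_block_le hq hcop hα hβ (h₀ + j * q) hX _ (fun i _ => hF _) fun i _ => ?_
        have := hF' (j * q + i)
        push_cast at this ⊢
        rw [add_assoc]
        exact this
    _ ≤ _ := by
        rw [sum_const, card_range, nsmul_eq_mul]
        gcongr
        push_cast
        gcongr
        exact Nat.cast_div_le

/-! ### The divisor bound -/

/-- The bound `τ n ≪ n ^ δ`. In `∏ (v + 1)` a prime `p ≥ 2 ^ (1 / δ)` contributes at most
`2 ^ v ≤ p ^ (δ v)`, and each of the boundedly many smaller ones loses a constant factor. -/
lemma exists_card_divisors_le (δ : ℝ) (hδ : 0 < δ) :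
    ∃ C : ℝ, 1 ≤ C ∧ ∀ n : ℕ, n ≠ 0 → (#n.divisors : ℝ) ≤ C * (n : ℝ) ^ δ := by
  have hlog2 := Real.log_pos (show (1 : ℝ) < 2 by norm_num)
  set K : ℝ := 1 + 1 / (δ * Real.log 2) with hK
  have hK1 : 1 ≤ K := by rw [hK]; have : 0 ≤ 1 / (δ * Real.log 2) := by positivity
                         linarith
  set P : ℕ := ⌈(2 : ℝ) ^ (1 / δ)⌉₊ with hP
  refine ⟨K ^ P, one_le_pow₀ hK1, fun n hn => ?_⟩
  have hfac : ∀ p ∈ n.primeFactors, ((n.factorization p : ℝ) + 1) ≤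
      (if p < P then K else 1) * ((p : ℝ) ^ (n.factorization p)) ^ δ := by
    intro p hp
    have hp2 : (2 : ℝ) ≤ p := by exact_mod_cast (Nat.prime_of_mem_primeFactors hp).two_le
    generalize n.factorization p = v
    have hexp : ((p : ℝ) ^ v) ^ δ = ((p : ℝ) ^ δ) ^ v := by
      rw [← Real.rpow_natCast, ← Real.rpow_mul (by linarith), mul_comm, Real.rpow_mul (by linarith),
        Real.rpow_natCast]
    split_ifs with h
    · have h1 : 1 + δ * Real.log 2 * v ≤ ((p : ℝ) ^ δ) ^ v := by
        calc 1 + δ * Real.log 2 * v ≤ Real.exp (δ * Real.log 2 * v) := by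
              rw [add_comm]; exact Real.add_one_le_exp _
          _ = ((2 : ℝ) ^ δ) ^ v := by
              rw [Real.rpow_def_of_pos (by norm_num), ← Real.exp_nat_mul]; congr 1; ring
          _ ≤ _ := by gcongr
      rw [hexp]
      have h2 : (v : ℝ) + 1 ≤ K * (1 + δ * Real.log 2 * v) := by
        have hpos : 0 < δ * Real.log 2 := by positivity
        have e1 : K * (1 + δ * Real.log 2 * v) = 1 + v + (δ * Real.log 2 * v + 1 / (δ * Real.log 2)) := by
          rw [hK]; field_simp; ring
        rw [e1]
        have : 0 ≤ δ * Real.log 2 * v + 1 / (δ * Real.log 2) := by positivity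
        linarith
      exact h2.trans (by gcongr)
    · rw [one_mul, hexp]
      have h1 : (2 : ℝ) ≤ (p : ℝ) ^ δ := by
        have h3 : (2 : ℝ) ^ (1 / δ) ≤ p := (Nat.le_ceil _).trans (by exact_mod_cast not_lt.mp h)
        calc (2 : ℝ) = ((2 : ℝ) ^ (1 / δ)) ^ δ := by
              rw [← Real.rpow_mul (by norm_num), one_div_mul_cancel hδ.ne', Real.rpow_one]
          _ ≤ _ := by gcongr
      have h2 : (v : ℝ) + 1 ≤ 2 ^ v := by exact_mod_cast Nat.lt_two_pow_self (n := v)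
      exact h2.trans (by gcongr)
  rw [Nat.card_divisors hn]
  push_cast
  calc ∏ p ∈ n.primeFactors, ((n.factorization p : ℝ) + 1)
      ≤ ∏ p ∈ n.primeFactors, (if p < P then K else 1) * ((p : ℝ) ^ (n.factorization p)) ^ δ :=
        prod_le_prod (fun p _ => by positivity) hfac
    _ = K ^ #{p ∈ n.primeFactors | p < P} * (n : ℝ) ^ δ := by
        rw [prod_mul_distrib, ← prod_filter, prod_const,
          Real.finsetProd_rpow _ _ (fun p _ => by positivity)]
        congr 2
        conv_rhs => rw [← Nat.prod_factorization_pow_eq_self hn]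
        rw [Finsupp.prod, Nat.support_factorization]
        push_cast; rfl
    _ ≤ K ^ P * (n : ℝ) ^ δ := by
        gcongr
        calc #{p ∈ n.primeFactors | p < P} ≤ #(range P) :=
              card_le_card fun p hp => mem_range.mpr (mem_filter.mp hp).2
          _ = P := card_range P

/-! ### Linear sums -/

/-- Collecting `k = c * r * m` into one variable costs the divisor function. -/
lemma sum_sum_mul_le {c R M : ℕ} (hc : 1 ≤ c) (s : Finset ℕ) (hs : ∀ m ∈ s, 1 ≤ m ∧ m ≤ M)
    (G : ℕ → ℝ) (hG : ∀ k, 0 ≤ G k) {T : ℝ}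
    (hT : ∀ k : ℕ, 1 ≤ k → k ≤ c * R * M → (#k.divisors : ℝ) ≤ T) :
    ∑ r ∈ Icc 1 R, ∑ m ∈ s, G (c * r * m) ≤ T * ∑ k ∈ Icc 1 (c * R * M), G k := by
  rw [← sum_product']
  have hmaps : ∀ x ∈ Icc 1 R ×ˢ s, c * x.1 * x.2 ∈ Icc 1 (c * R * M) := by
    intro x hx
    rw [mem_product, mem_Icc] at hx
    have h2 := hs _ hx.2
    rw [mem_Icc]
    exact ⟨Nat.mul_pos (Nat.mul_pos hc hx.1.1) h2.1,
      Nat.mul_le_mul (Nat.mul_le_mul_left c hx.1.2) h2.2⟩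
  rw [← sum_fiberwise_of_maps_to hmaps, mul_sum]
  refine sum_le_sum fun k hk => ?_
  rw [sum_congr rfl (g := fun _ => G k) (fun x hx => by rw [(mem_filter.mp hx).2]), sum_const,
    nsmul_eq_mul]
  rw [mem_Icc] at hk
  refine mul_le_mul_of_nonneg_right (le_trans ?_ (hT k hk.1 hk.2)) (hG k)
  have : #{x ∈ Icc 1 R ×ˢ s | c * x.1 * x.2 = k} ≤ #k.divisors := by
    refine card_le_card_of_injOn (fun x => x.1) ?_ ?_
    · intro x hx
      simp only [coe_filter, Set.mem_ofPred_eq] at hx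
      rw [mem_coe, Nat.mem_divisors]
      exact ⟨⟨c * x.2, by rw [← hx.2]; ring⟩, by omega⟩
    · intro x hx y hy hxy
      simp only [coe_filter, Set.mem_ofPred_eq, mem_product, mem_Icc] at hx hy hxy
      have h1 : c * x.1 * x.2 = c * x.1 * y.2 := by rw [hx.2, hxy, hy.2]
      have h2 := Nat.eq_of_mul_eq_mul_left (Nat.mul_pos hc hx.1.1.1) h1
      exact Prod.ext hxy h2
  exact_mod_cast this

/-- The sum over the multiples `d * l ≡ 1 mod 4` of `d` up to `N`. -/
noncomputable def progressionSum (α : ℝ) (N r d : ℕ) : ℂ :=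
  ∑ l ∈ Icc 1 (N / d), if d * l % 4 = 1 then e ((r : ℝ) * d * l * α) else 0

/-- The `l` in question form one residue class modulo `4`, which is empty for even `d`. -/
lemma progressionSum_eq (α : ℝ) (N r d : ℕ) : ∃ (K : ℕ) (φ : ℝ), K ≤ N / d ∧
    progressionSum α N r d = ∑ t ∈ range K, e (φ + t * (((4 * r * d : ℕ) : ℝ) * α)) := by
  have key : ∀ c : ℕ, 1 ≤ c → c < 4 → (∀ l : ℕ, d * l % 4 = 1 ↔ l % 4 = c) →
      progressionSum α N r d = ∑ t ∈ range ((N / d + 4 - c) / 4),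
        e ((r : ℝ) * d * c * α + t * (((4 * r * d : ℕ) : ℝ) * α)) := by
    intro c hc hc4 hiff
    unfold progressionSum
    simp only [hiff]
    rw [← sum_filter]
    refine sum_nbij' (fun l => l / 4) (fun t => c + 4 * t) ?_ ?_ ?_ ?_ ?_
    · intro l hl
      rw [mem_filter, mem_Icc] at hl
      rw [mem_range]; omega
    · intro t ht
      rw [mem_range] at ht
      rw [mem_filter, mem_Icc]; omega
    · intro l hl
      rw [mem_filter] at hl
      omega
    · intro t _
      omega
    · intro l hl
      rw [mem_filter] at hl
      have hl4 : (l : ℝ) = c + 4 * ((l / 4 : ℕ) : ℝ) := by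
        have : l = c + 4 * (l / 4) := by omega
        exact_mod_cast this
      congr 1
      conv_lhs => rw [hl4]
      push_cast; ring
  have h4 : d % 4 = 0 ∨ d % 4 = 1 ∨ d % 4 = 2 ∨ d % 4 = 3 := by omega
  have hmod : ∀ l : ℕ, d * l % 4 = (d % 4) * (l % 4) % 4 := fun l => Nat.mul_mod _ _ _
  have hl4 : ∀ l : ℕ, l % 4 = 0 ∨ l % 4 = 1 ∨ l % 4 = 2 ∨ l % 4 = 3 := fun l => by omega
  have hzero : (∀ l : ℕ, d * l % 4 ≠ 1) → progressionSum α N r d = 0 := by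
    intro h
    unfold progressionSum
    exact sum_eq_zero fun l _ => if_neg (h l)
  rcases h4 with h | h | h | h
  · refine ⟨0, 0, Nat.zero_le _, ?_⟩
    rw [hzero, range_zero, sum_empty]
    intro l; rw [hmod, h]; omega
  · refine ⟨_, _, ?_, key 1 le_rfl (by norm_num) fun l => ?_⟩
    · generalize N / d = x; omega
    · rw [hmod, h]; omega
  · refine ⟨0, 0, Nat.zero_le _, ?_⟩
    rw [hzero, range_zero, sum_empty]
    intro l; rw [hmod, h]; omega
  · refine ⟨_, _, ?_, key 3 (by norm_num) (by norm_num) fun l => ?_⟩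
    · generalize N / d = x; omega
    · rw [hmod, h]; omega

/-- For `0 < k ≤ q / 2` the number `k a / q` is at least `1 / q` away from the integers, and `k β` is
at most half as large. -/
lemma one_div_le_distToInt {α β : ℝ} {a : ℤ} {q : ℕ} (hcop : IsCoprime a (q : ℤ))
    (hα : α = (a : ℝ) / q + β) (hβ : (q : ℝ) ^ 2 * |β| ≤ 1) {k : ℕ} (hk : 1 ≤ k) (hkq : 2 * k ≤ q) :
    1 / (2 * (q : ℝ)) ≤ distToInt (k * α) := by
  have hq0 : (0 : ℝ) < q := by exact_mod_cast (by omega : 0 < q)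
  rw [distToInt]
  set n := round ((k : ℝ) * α)
  have hne : (k : ℤ) * a - n * q ≠ 0 := by
    intro h
    have h1 : (q : ℤ) ∣ k * a := ⟨n, by linarith⟩
    have h2 : (q : ℤ) ∣ k := hcop.symm.dvd_of_dvd_mul_right h1
    have h3 := Nat.le_of_dvd (by omega) (Int.natCast_dvd_natCast.mp h2)
    omega
  have h1 : (1 : ℝ) ≤ |(k : ℝ) * a - n * q| := by exact_mod_cast Int.one_le_abs hne
  have e1 : (q : ℝ) * (k * α - n) = (k * a - n * q) + q * (k * β) := by
    rw [hα]; field_simp; ring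
  have h2 : |(q : ℝ) * (k * β)| ≤ 1 / 2 := by
    have hkr : (2 : ℝ) * k ≤ q := by exact_mod_cast hkq
    rw [abs_mul, abs_mul, Nat.abs_cast, Nat.abs_cast]
    have : (2 * (k : ℝ)) * (q * |β|) ≤ q * (q * |β|) := by gcongr
    nlinarith
  have h3 : (1 : ℝ) / 2 ≤ q * |k * α - n| := by
    rw [show (q : ℝ) * |k * α - n| = |q * (k * α - n)| by rw [abs_mul, Nat.abs_cast], e1]
    have := abs_sub_abs_le_abs_sub ((k : ℝ) * a - n * q) (-(q * (k * β)))
    rw [abs_neg, sub_neg_eq_add] at this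
    linarith
  rw [div_le_iff₀ (by positivity)]
  linarith

/-- `∑ min (Y / k, 1 / ‖k α‖)` over `1 ≤ k ≤ L`, in blocks of length `q`. In the first block the
terms with `k ≤ q / 2` are at most `2 q` because `‖k α‖` is not small. -/
lemma sum_hyperbolic_le {α β : ℝ} {a : ℤ} {q : ℕ} (hq : 1 ≤ q) (hcop : IsCoprime a (q : ℤ))
    (hα : α = (a : ℝ) / q + β) (hβ : (q : ℝ) ^ 2 * |β| ≤ 1) {Y : ℝ} (hY : 0 ≤ Y) (L : ℕ)
    (F : ℕ → ℝ) (hF0 : ∀ k, 0 ≤ F k) (hF : ∀ k, 1 ≤ k → F k ≤ Y / k)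
    (hF' : ∀ k, F k * distToInt (k * α) ≤ 1) :
    ∑ k ∈ Icc 1 L, F k ≤
      6 * ((L + q) * (3 + Real.log q)) + 12 * (Y / q * (1 + Real.log (L + 1))) := by
  have hq0 : (0 : ℝ) < q := by exact_mod_cast hq
  have hlog : 0 ≤ Real.log q := Real.log_nonneg (by exact_mod_cast hq)
  have hL : L ≤ (L / q + 1) * q := by
    have := Nat.lt_div_mul_add (a := L) (b := q) (by omega)
    rw [add_mul, one_mul]; omega
  have hblock : ∀ j < L / q + 1, ∑ i ∈ range q, F (j * q + i + 1) ≤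
      6 * (q * (3 + Real.log q)) + 12 * (Y / q) * (1 / ((j : ℝ) + 1)) := by
    intro j _
    have hjq : (0 : ℝ) < ((j : ℝ) + 1) * q := by positivity
    have := sum_block_le hq hcop hα hβ (j * q + 1) (X := 2 * q + 2 * Y / ((j + 1) * q))
      (by positivity) (fun i => F (j * q + i + 1)) ?_ ?_
    · refine this.trans (le_of_eq ?_)
      field_simp; ring
    · intro i hi
      have hk1 : (1 : ℝ) ≤ ((j * q + i + 1 : ℕ) : ℝ) := by exact_mod_cast Nat.le_add_left _ _
      by_cases hk : 2 * (j * q + i + 1) ≤ q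
      · have h1 := one_div_le_distToInt hcop hα hβ (Nat.le_add_left 1 (j * q + i)) hk
        have h2 := hF' (j * q + i + 1)
        have h3 := mul_le_mul_of_nonneg_left h1 (hF0 (j * q + i + 1))
        have h4 : F (j * q + i + 1) ≤ 2 * q := by
          have := h3.trans h2
          rw [mul_one_div, div_le_iff₀ (by positivity)] at this
          linarith
        have : 0 ≤ 2 * Y / ((j + 1) * q) := by positivity
        linarith
      · have h1 := hF (j * q + i + 1) (Nat.le_add_left 1 _)
        have h2 : Y / ((j * q + i + 1 : ℕ) : ℝ) ≤ 2 * Y / ((j + 1) * q) := by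
          rw [div_le_div_iff₀ (by linarith) hjq]
          have h3 : (j + 1) * q ≤ 2 * (j * q + i + 1) := by
            rw [not_le] at hk
            rcases Nat.eq_zero_or_pos j with rfl | hj
            · omega
            · nlinarith [Nat.mul_le_mul_right q hj]
          have h4 : ((j : ℝ) + 1) * q ≤ 2 * ((j * q + i + 1 : ℕ) : ℝ) := by exact_mod_cast h3
          nlinarith
        linarith
    · intro i _
      have := hF' (j * q + i + 1)
      push_cast at this ⊢
      rw [show (j : ℝ) * q + 1 + i = j * q + i + 1 by ring]
      exact this
  have hdiv : ((L / q : ℕ) : ℝ) ≤ L / q := Nat.cast_div_le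
  have hJ : (((L / q + 1 : ℕ)) : ℝ) ≤ L / q + 1 := by push_cast; linarith
  calc ∑ k ∈ Icc 1 L, F k = ∑ i ∈ range L, F (i + 1) := by
        rw [range_eq_Ico, sum_Ico_add' F 0 L 1]; rfl
    _ ≤ ∑ i ∈ range ((L / q + 1) * q), F (i + 1) :=
        sum_le_sum_of_subset_of_nonneg (range_subset_range.mpr hL) fun i _ _ => hF0 _
    _ ≤ ∑ j ∈ range (L / q + 1),
          (6 * (q * (3 + Real.log q)) + 12 * (Y / q) * (1 / ((j : ℝ) + 1))) :=
        sum_range_mul_le q _ (fun i => F (i + 1)) _ hblock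
    _ = ((L / q + 1 : ℕ) : ℝ) * (6 * (q * (3 + Real.log q)))
          + 12 * (Y / q) * ((harmonic (L / q + 1) : ℚ) : ℝ) := by
        rw [sum_add_distrib, sum_const, card_range, nsmul_eq_mul, ← mul_sum, harmonic]
        push_cast; simp
    _ ≤ ((L : ℝ) / q + 1) * (6 * (q * (3 + Real.log q)))
          + 12 * (Y / q) * (1 + Real.log (L + 1)) := by
        gcongr
        refine (harmonic_le_one_add_log _).trans ?_
        gcongr
        have : L / q ≤ L := Nat.div_le_self L q
        exact_mod_cast Nat.succ_le_succ this
    _ = _ := by field_simp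

/-- The linear sums: the moduli `4 r d` are collected into one variable. -/
lemma sum_progressionSum_le {α β : ℝ} {a : ℤ} {q : ℕ} (hq : 1 ≤ q) (hcop : IsCoprime a (q : ℤ))
    (hα : α = (a : ℝ) / q + β) (hβ : (q : ℝ) ^ 2 * |β| ≤ 1) (N R D : ℕ) {T : ℝ}
    (hT : ∀ k : ℕ, 1 ≤ k → k ≤ 4 * R * D → (#k.divisors : ℝ) ≤ T) (hT0 : 0 ≤ T) :
    ∑ r ∈ Icc 1 R, ∑ d ∈ Icc 1 D, ‖progressionSum α N r d‖ ≤
      T * (6 * ((4 * R * D + q) * (3 + Real.log q))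
        + 48 * (R * N / q * (1 + Real.log (4 * R * D + 1)))) := by
  set Y : ℝ := 4 * R * N with hY
  -- `min (Y / k) (1 / ‖k α‖)`, without the junk value of the quotient at `‖k α‖ = 0`.
  set F : ℕ → ℝ := fun k => if distToInt (k * α) = 0 then Y / k else min (Y / k) (1 / distToInt (k * α))
    with hF
  have hF0 : ∀ k, 0 ≤ F k := by
    intro k
    simp only [hF]
    have := distToInt_nonneg (k * α)
    split_ifs
    · positivity
    · exact le_min (by positivity) (by positivity)
  have hle : ∀ r ∈ Icc 1 R, ∀ d ∈ Icc 1 D, ‖progressionSum α N r d‖ ≤ F (4 * r * d) := by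
    intro r hr d hd
    rw [mem_Icc] at hr hd
    obtain ⟨K, φ, hK, h⟩ := progressionSum_eq α N r d
    have hd0 : (0 : ℝ) < d := by exact_mod_cast hd.1
    have hr0 : (0 : ℝ) < r := by exact_mod_cast hr.1
    have h1 : ‖progressionSum α N r d‖ ≤ Y / ((4 * r * d : ℕ) : ℝ) := by
      rw [h]
      calc _ ≤ (K : ℝ) := norm_sum_e_le K _
        _ ≤ ((N / d : ℕ) : ℝ) := by exact_mod_cast hK
        _ ≤ (N : ℝ) / d := Nat.cast_div_le
        _ ≤ Y / ((4 * r * d : ℕ) : ℝ) := by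
          rw [div_le_div_iff₀ hd0 (by push_cast; positivity), hY]
          push_cast
          have : (r : ℝ) ≤ R := by exact_mod_cast hr.2
          have h5 : (0 : ℝ) ≤ 4 * N * d := by positivity
          nlinarith [mul_le_mul_of_nonneg_left this h5]
    have h2 : ‖progressionSum α N r d‖ * distToInt (((4 * r * d : ℕ) : ℝ) * α) ≤ 1 := by
      rw [h]; exact norm_sum_e_mul_distToInt_le K φ _
    simp only [hF]
    split_ifs with h0
    · exact h1
    · refine le_min h1 ?_
      rw [le_div_iff₀ (lt_of_le_of_ne (distToInt_nonneg _) (Ne.symm h0))]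
      exact h2
  calc _ ≤ ∑ r ∈ Icc 1 R, ∑ d ∈ Icc 1 D, F (4 * r * d) :=
        sum_le_sum fun r hr => sum_le_sum fun d hd => hle r hr d hd
    _ ≤ T * ∑ k ∈ Icc 1 (4 * R * D), F k :=
        sum_sum_mul_le (by norm_num) _ (fun d hd => mem_Icc.mp hd) F hF0 hT
    _ ≤ T * (6 * (((4 * R * D : ℕ) + q) * (3 + Real.log q))
          + 12 * (Y / q * (1 + Real.log ((4 * R * D : ℕ) + 1)))) := by
        refine mul_le_mul_of_nonneg_left ?_ hT0
        refine sum_hyperbolic_le hq hcop hα hβ (by positivity) _ F hF0 ?_ ?_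
        · intro k _
          simp only [hF]
          split_ifs
          · exact le_rfl
          · exact min_le_left _ _
        · intro k
          simp only [hF]
          split_ifs with h0
          · rw [h0, mul_zero]; exact zero_le_one
          · have hpos := lt_of_le_of_ne (distToInt_nonneg (k * α)) (Ne.symm h0)
            rw [← le_div_iff₀ hpos]
            exact min_le_right _ _
    _ = _ := by rw [hY]; push_cast; ring

/-! ### Separable kernels and bilinear sums -/

/-- `Separable k K`: the kernel `k` is a finite linear combination of products `x m * y l` of functions
bounded by `1`, with coefficients of total size `K` in absolute value. -/
inductive Separable : (ℕ → ℕ → ℂ) → ℝ → Prop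
  | prod (x y : ℕ → ℂ) (hx : ∀ m, ‖x m‖ ≤ 1) (hy : ∀ l, ‖y l‖ ≤ 1) :
      Separable (fun m l => x m * y l) 1
  | add {k k' : ℕ → ℕ → ℂ} {K K' : ℝ} : Separable k K → Separable k' K' →
      Separable (fun m l => k m l + k' m l) (K + K')
  | smul (c : ℂ) {k : ℕ → ℕ → ℂ} {K : ℝ} : Separable k K →
      Separable (fun m l => c * k m l) (‖c‖ * K)

namespace Separable

lemma congr {k k' : ℕ → ℕ → ℂ} {K K' : ℝ} (h : Separable k K) (hk : ∀ m l, k' m l = k m l)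
    (hK : K' = K) : Separable k' K' := by
  have : k' = k := funext fun m => funext fun l => hk m l
  rw [this, hK]; exact h

lemma left (x : ℕ → ℂ) (hx : ∀ m, ‖x m‖ ≤ 1) : Separable (fun m _ => x m) 1 :=
  (prod x (fun _ => 1) hx (by simp)).congr (by simp) rfl

lemma one : Separable (fun _ _ => 1) 1 := left (fun _ => 1) (by simp)

lemma zero : Separable (fun _ _ => 0) 0 := (one.smul 0).congr (by simp) (by simp)

lemma prod_mul {k : ℕ → ℕ → ℂ} {K : ℝ} (h : Separable k K) (x y : ℕ → ℂ) (hx : ∀ m, ‖x m‖ ≤ 1)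
    (hy : ∀ l, ‖y l‖ ≤ 1) : Separable (fun m l => x m * y l * k m l) K := by
  induction h with
  | prod x' y' hx' hy' =>
    refine (prod (fun m => x m * x' m) (fun l => y l * y' l) (fun m => ?_) (fun l => ?_)).congr
      (fun m l => by ring) rfl
    · rw [norm_mul]; exact mul_le_one₀ (hx m) (norm_nonneg _) (hx' m)
    · rw [norm_mul]; exact mul_le_one₀ (hy l) (norm_nonneg _) (hy' l)
  | add _ _ ih ih' => exact (ih.add ih').congr (fun m l => by ring) rfl
  | smul c _ ih => exact (ih.smul c).congr (fun m l => by ring) rfl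

lemma mul {k k' : ℕ → ℕ → ℂ} {K K' : ℝ} (h : Separable k K) (h' : Separable k' K') :
    Separable (fun m l => k m l * k' m l) (K * K') := by
  induction h with
  | prod x y hx hy => exact (h'.prod_mul x y hx hy).congr (fun _ _ => rfl) (one_mul _)
  | add _ _ ih₁ ih₂ => exact (ih₁.add ih₂).congr (fun m l => by ring) (by ring)
  | smul c _ ih => exact (ih.smul c).congr (fun m l => by ring) (by ring)

/-- Binary digits: `f = g` iff the integral halves agree and so do the signs `(-1) ^ f`, `(-1) ^ g`. -/
lemma indicator_eq (n : ℕ) (f g : ℕ → ℕ) (hf : ∀ m, f m < 2 ^ n) (hg : ∀ l, g l < 2 ^ n) :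
    Separable (fun m l => if f m = g l then 1 else 0) 1 := by
  induction n generalizing f g with
  | zero =>
    refine one.congr (fun m l => ?_) rfl
    have h1 := hf m
    have h2 := hg l
    rw [if_pos (by omega)]
  | succ n ih =>
    have h1 := ih (fun m => f m / 2) (fun l => g l / 2)
      (fun m => by have := hf m; rw [pow_succ] at this; omega)
      (fun l => by have := hg l; rw [pow_succ] at this; omega)
    have h2 := (one.smul (1 / 2)).add ((prod (fun m => (-1) ^ f m) (fun l => (-1) ^ g l)
      (by simp) (by simp)).smul (1 / 2))
    refine (h1.mul h2).congr (fun m l => ?_) (by norm_num)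
    rw [← pow_add]
    by_cases hm : f m / 2 = g l / 2
    · by_cases hp : f m = g l
      · have : Even (f m + g l) := ⟨g l, by omega⟩
        rw [if_pos hp, if_pos hm, this.neg_one_pow]; norm_num
      · have : Odd (f m + g l) := by rw [Nat.odd_iff]; omega
        rw [if_neg hp, this.neg_one_pow]; norm_num
    · rw [if_neg hm, if_neg (fun h => hm (by rw [h])), zero_mul]

/-- Binary digits: `f < g` iff the integral halves satisfy the same inequality, or they agree while
`f` is even and `g` is odd. -/
lemma indicator_lt (n : ℕ) (f g : ℕ → ℕ) (hf : ∀ m, f m < 2 ^ n) (hg : ∀ l, g l < 2 ^ n) :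
    Separable (fun m l => if f m < g l then 1 else 0) n := by
  induction n generalizing f g with
  | zero =>
    refine zero.congr (fun m l => ?_) (by simp)
    have h1 := hf m
    have h2 := hg l
    rw [if_neg (by omega)]
  | succ n ih =>
    have hf' : ∀ m, f m / 2 < 2 ^ n := fun m => by have := hf m; rw [pow_succ] at this; omega
    have hg' : ∀ l, g l / 2 < 2 ^ n := fun l => by have := hg l; rw [pow_succ] at this; omega
    have h1 := ih (fun m => f m / 2) (fun l => g l / 2) hf' hg'
    have h2 := (indicator_eq n (fun m => f m / 2) (fun l => g l / 2) hf' hg').prod_mul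
      (fun m => if f m % 2 = 0 then 1 else 0) (fun l => if g l % 2 = 1 then 1 else 0)
      (fun m => by split_ifs <;> simp) (fun l => by split_ifs <;> simp)
    refine (h1.add h2).congr (fun m l => ?_) (by push_cast; ring)
    rcases lt_trichotomy (f m / 2) (g l / 2) with h | h | h
    · rw [if_pos (by omega), if_pos h, if_neg h.ne]; simp
    · rw [if_neg h.not_lt, if_pos h]
      have h3 := Nat.mod_two_eq_zero_or_one (f m)
      have h4 := Nat.mod_two_eq_zero_or_one (g l)
      rcases h3 with h3 | h3 <;> rcases h4 with h4 | h4
      · rw [if_neg (by omega), h3, h4]; simp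
      · rw [if_pos (by omega), h3, h4]; simp
      · rw [if_neg (by omega), h3, h4]; simp
      · rw [if_neg (by omega), h3, h4]; simp
    · have h3 : ¬ f m < g l := by omega
      rw [if_neg h3, if_neg h.not_gt, if_neg h.ne']; simp

lemma indicator_mul_mod_four : Separable (fun m l => if m * l % 4 = 1 then 1 else 0) 2 := by
  have h : ∀ c : ℕ, Separable (fun m l => (if m % 4 = c then 1 else 0) * (if l % 4 = c then 1 else 0)) 1 :=
    fun c => prod (fun m => if m % 4 = c then 1 else 0) (fun l => if l % 4 = c then 1 else 0)
      (fun m => by split_ifs <;> simp) (fun l => by split_ifs <;> simp)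
  refine ((h 1).add (h 3)).congr (fun m l => ?_) (by norm_num)
  rw [Nat.mul_mod]
  have h1 := Nat.mod_lt m (show 0 < 4 by norm_num)
  have h2 := Nat.mod_lt l (show 0 < 4 by norm_num)
  interval_cases m % 4 <;> interval_cases l % 4 <;> norm_num

end Separable

/-- A bilinear sum with separable kernel is controlled by those with kernel `x m * y l`. -/
lemma Separable.sum_norm_le {k : ℕ → ℕ → ℂ} {K : ℝ} (h : Separable k K) (α : ℝ) (R : ℕ)
    (s t : Finset ℕ) {V : ℝ}
    (hV : ∀ x y : ℕ → ℂ, (∀ m, ‖x m‖ ≤ 1) → (∀ l, ‖y l‖ ≤ 1) →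
      ∑ r ∈ Icc 1 R, ‖∑ m ∈ s, ∑ l ∈ t, x m * y l * e ((r : ℝ) * m * l * α)‖ ≤ V) :
    ∑ r ∈ Icc 1 R, ‖∑ m ∈ s, ∑ l ∈ t, k m l * e ((r : ℝ) * m * l * α)‖ ≤ K * V := by
  induction h with
  | prod x y hx hy => rw [one_mul]; exact hV x y hx hy
  | add _ _ ih ih' =>
    rw [add_mul]
    refine le_trans ?_ (add_le_add ih ih')
    rw [← sum_add_distrib]
    refine sum_le_sum fun r _ => ?_
    simp only [add_mul, sum_add_distrib]
    exact norm_add_le _ _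
  | smul c _ ih =>
    rw [mul_assoc]
    refine le_trans (le_of_eq ?_) (mul_le_mul_of_nonneg_left ih (norm_nonneg c))
    rw [mul_sum]
    refine sum_congr rfl fun r _ => ?_
    rw [← norm_mul, mul_sum]
    simp only [mul_sum, mul_assoc]

lemma sum_Icc_one_eq_sum_range {M : Type*} [AddCommMonoid M] (F : ℕ → M) (K : ℕ) :
    ∑ k ∈ Icc 1 K, F k = ∑ i ∈ range K, F (i + 1) := by
  rw [range_eq_Ico, sum_Ico_add' F 0 K 1]; rfl

/-- Opening the square and summing over `k` first leaves geometric sums with ratios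
`e ((l - l') * α)`. -/
lemma sum_norm_sq_le {α β : ℝ} {a : ℤ} {q : ℕ} (hq : 1 ≤ q) (hcop : IsCoprime a (q : ℤ))
    (hα : α = (a : ℝ) / q + β) (hβ : (q : ℝ) ^ 2 * |β| ≤ 1) (K H : ℕ) (y : ℕ → ℂ)
    (hy : ∀ l, ‖y l‖ ≤ 1) :
    ∑ k ∈ Icc 1 K, ‖∑ l ∈ Icc 1 H, y l * e ((k : ℝ) * l * α)‖ ^ 2 ≤
      H * (((H : ℝ) / q + 1) * (6 * (K + q * (1 + Real.log q)))) := by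
  have hexp : ((∑ k ∈ Icc 1 K, ‖∑ l ∈ Icc 1 H, y l * e ((k : ℝ) * l * α)‖ ^ 2 : ℝ) : ℂ)
      = ∑ l' ∈ Icc 1 H, ∑ l ∈ Icc 1 H, y l * (starRingEnd ℂ) (y l') *
          ∑ k ∈ Icc 1 K, e ((k : ℝ) * (((l : ℤ) - l' : ℤ) : ℝ) * α) := by
    push_cast
    have h1 : ∀ k ∈ Icc 1 K, ((‖∑ l ∈ Icc 1 H, y l * e ((k : ℝ) * l * α)‖ : ℂ)) ^ 2
        = ∑ l' ∈ Icc 1 H, ∑ l ∈ Icc 1 H, y l * (starRingEnd ℂ) (y l') *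
          e ((k : ℝ) * (((l : ℤ) - l' : ℤ) : ℝ) * α) := by
      intro k _
      rw [← Complex.mul_conj', map_sum, mul_comm, sum_mul_sum]
      refine sum_congr rfl fun l' _ => sum_congr rfl fun l _ => ?_
      rw [map_mul, conj_e, show (k : ℝ) * (((l : ℤ) - l' : ℤ) : ℝ) * α
        = (k : ℝ) * l * α + -((k : ℝ) * l' * α) by push_cast; ring, e_add]
      ring
    rw [sum_congr rfl h1, sum_comm]
    refine sum_congr rfl fun l' _ => ?_
    rw [sum_comm]
    refine sum_congr rfl fun l _ => ?_
    rw [mul_sum]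
    simp
  have hnn : 0 ≤ ∑ k ∈ Icc 1 K, ‖∑ l ∈ Icc 1 H, y l * e ((k : ℝ) * l * α)‖ ^ 2 :=
    sum_nonneg fun _ _ => by positivity
  rw [← Complex.norm_of_nonneg hnn, hexp]
  have hinner : ∀ l' ∈ Icc 1 H, ‖∑ l ∈ Icc 1 H, y l * (starRingEnd ℂ) (y l') *
      ∑ k ∈ Icc 1 K, e ((k : ℝ) * (((l : ℤ) - l' : ℤ) : ℝ) * α)‖ ≤
      ((H : ℝ) / q + 1) * (6 * (K + q * (1 + Real.log q))) := by
    intro l' _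
    have hshift : ∀ h : ℤ, ∑ k ∈ Icc 1 K, e ((k : ℝ) * (h : ℝ) * α)
        = ∑ k ∈ range K, e ((h : ℝ) * α + k * ((h : ℝ) * α)) := by
      intro h
      rw [sum_Icc_one_eq_sum_range]
      refine sum_congr rfl fun k _ => ?_
      congr 1
      push_cast; ring
    have hbd := sum_interval_le hq hcop hα hβ (1 - (l' : ℤ)) (Nat.cast_nonneg K) H
      (fun i => ‖∑ k ∈ range K, e ((((1 - (l' : ℤ) + i : ℤ)) : ℝ) * α
        + k * ((((1 - (l' : ℤ) + i : ℤ)) : ℝ) * α))‖)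
      (fun i => norm_nonneg _) (fun i => norm_sum_e_le K _)
      (fun i => norm_sum_e_mul_distToInt_le K _ _)
    refine le_trans ?_ hbd
    refine (norm_sum_le _ _).trans ?_
    rw [sum_Icc_one_eq_sum_range]
    refine sum_le_sum fun i _ => ?_
    rw [hshift, norm_mul, norm_mul, RCLike.norm_conj]
    have h1 : (((i + 1 : ℕ) : ℤ) - l' : ℤ) = 1 - (l' : ℤ) + i := by push_cast; ring
    rw [h1]
    exact mul_le_of_le_one_left (norm_nonneg _) (mul_le_one₀ (hy _) (norm_nonneg _) (hy _))
  refine (norm_sum_le _ _).trans ((sum_le_sum hinner).trans (le_of_eq ?_))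
  rw [sum_const, Nat.card_Icc, nsmul_eq_mul]; simp

/-- Bilinear sums with coefficients `x m * y l`: the product `k = r * m` is taken as one variable and
Cauchy's inequality removes `x`. -/
lemma sum_norm_bilinear_le {α β : ℝ} {a : ℤ} {q : ℕ} (hq : 1 ≤ q) (hcop : IsCoprime a (q : ℤ))
    (hα : α = (a : ℝ) / q + β) (hβ : (q : ℝ) ^ 2 * |β| ≤ 1) (R M H : ℕ) (s : Finset ℕ)
    (hs : ∀ m ∈ s, 1 ≤ m ∧ m ≤ M) {T : ℝ}
    (hT : ∀ k : ℕ, 1 ≤ k → k ≤ R * M → (#k.divisors : ℝ) ≤ T) (hT0 : 0 ≤ T) (x y : ℕ → ℂ)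
    (hx : ∀ m, ‖x m‖ ≤ 1) (hy : ∀ l, ‖y l‖ ≤ 1) :
    ∑ r ∈ Icc 1 R, ‖∑ m ∈ s, ∑ l ∈ Icc 1 H, x m * y l * e ((r : ℝ) * m * l * α)‖ ≤
      T * √((R * M) * (H * (((H : ℝ) / q + 1) * (6 * (R * M + q * (1 + Real.log q)))))) := by
  set G : ℕ → ℝ := fun k => ‖∑ l ∈ Icc 1 H, y l * e ((k : ℝ) * l * α)‖ with hG
  have h1 : ∀ r ∈ Icc 1 R, ‖∑ m ∈ s, ∑ l ∈ Icc 1 H, x m * y l * e ((r : ℝ) * m * l * α)‖ ≤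
      ∑ m ∈ s, G (1 * r * m) := by
    intro r _
    refine (norm_sum_le _ _).trans (sum_le_sum fun m _ => ?_)
    have : ∑ l ∈ Icc 1 H, x m * y l * e ((r : ℝ) * m * l * α)
        = x m * ∑ l ∈ Icc 1 H, y l * e (((1 * r * m : ℕ) : ℝ) * l * α) := by
      rw [mul_sum]
      refine sum_congr rfl fun l _ => ?_
      rw [one_mul]; push_cast; ring
    rw [this, norm_mul]
    exact mul_le_of_le_one_left (norm_nonneg _) (hx m)
  have h2 := sum_sum_mul_le (c := 1) (R := R) (M := M) le_rfl s hs G (fun _ => norm_nonneg _) (T := T)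
    (by rwa [one_mul])
  have h3 : ∑ k ∈ Icc 1 (1 * R * M), G k ≤
      √((R * M) * (H * (((H : ℝ) / q + 1) * (6 * (R * M + q * (1 + Real.log q)))))) := by
    refine Real.le_sqrt_of_sq_le ?_
    refine (sq_sum_le_card_mul_sum_sq (s := Icc 1 (1 * R * M)) (f := G)).trans ?_
    have h4 := sum_norm_sq_le hq hcop hα hβ (1 * R * M) H y hy
    have hc : ((#(Icc 1 (1 * R * M)) : ℕ) : ℝ) = R * M := by simp
    rw [hc]
    refine mul_le_mul_of_nonneg_left (h4.trans (le_of_eq ?_)) (by positivity)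
    push_cast; rw [one_mul]
  exact (sum_le_sum h1).trans (h2.trans (mul_le_mul_of_nonneg_left h3 hT0))

/-! ### Decomposition of the exponential sum -/

lemma sum_sum_divisors {M : Type*} [AddCommMonoid M] (f : ℕ → ℕ → M) (N : ℕ) :
    ∑ n ∈ Icc 1 N, ∑ d ∈ n.divisors, f d (n / d) = ∑ d ∈ Icc 1 N, ∑ l ∈ Icc 1 (N / d), f d l := by
  rw [sum_sigma', sum_sigma']
  refine sum_nbij' (fun x => ⟨x.2, x.1 / x.2⟩) (fun x => ⟨x.1 * x.2, x.1⟩) ?_ ?_ ?_ ?_ ?_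
  · rintro ⟨n, d⟩ h
    simp only [mem_sigma, mem_Icc, Nat.mem_divisors] at h ⊢
    have hd := Nat.pos_of_dvd_of_pos h.2.1 h.1.1
    have hle := Nat.le_of_dvd h.1.1 h.2.1
    exact ⟨⟨hd, hle.trans h.1.2⟩, Nat.div_pos hle hd, Nat.div_le_div_right h.1.2⟩
  · rintro ⟨d, l⟩ h
    simp only [mem_sigma, mem_Icc, Nat.mem_divisors] at h ⊢
    have h1 := Nat.mul_pos h.1.1 h.2.1
    exact ⟨⟨h1, (Nat.mul_le_mul_left d h.2.2).trans (Nat.mul_div_le N d)⟩, dvd_mul_right d l, h1.ne'⟩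
  · rintro ⟨n, d⟩ h
    simp only [mem_sigma, mem_Icc, Nat.mem_divisors] at h ⊢
    rw [Nat.mul_div_cancel' h.2.1]
  · rintro ⟨d, l⟩ h
    simp only [mem_sigma, mem_Icc] at h ⊢
    rw [Nat.mul_div_cancel_left l h.1.1]
  · rintro ⟨n, d⟩ _
    rfl

lemma Sifted.mono {l s t : ℕ} (h : Sifted l t) (hst : s ≤ t) : Sifted l s :=
  fun p hp => h p (hp.trans_le hst)

open Classical in
/-- The sieve condition becomes a comparison between a function of `m` and a function of `l`. -/
lemma sifted_iff_le_findGreatest {l t N : ℕ} (ht : t ≤ N) :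
    Sifted l t ↔ t ≤ Nat.findGreatest (Sifted l) N := by
  refine ⟨fun h => Nat.le_findGreatest ht h, fun h => Sifted.mono ?_ h⟩
  exact Nat.findGreatest_spec (P := Sifted l) (Nat.zero_le N) (fun p hp => absurd hp (Nat.not_lt_zero p))

open Classical in
/-- The coefficients of the bilinear part of the sieve, before the exponential. -/
noncomputable def bilinearKernel (A : ℝ) (m l : ℕ) : ℂ :=
  if m * l % 4 = 1 then bilinearWeight A m * (if Sifted l m.minFac then 1 else 0) else 0

/-- Up to `N` the bilinear kernel with the hyperbolic condition is separable at a cost of two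
logarithms. -/
lemma exists_separable_bilinearKernel (A : ℝ) (N : ℕ) : ∃ k : ℕ → ℕ → ℂ,
    Separable k (2 * ((Nat.log 2 N + 2 : ℕ) * ((Nat.log 2 N + 2 : ℕ) + 1))) ∧
    ∀ m l : ℕ, 1 ≤ m → m ≤ N → l ≤ N →
      k m l = if l ≤ N / m then bilinearKernel A m l else 0 := by
  classical
  set n := Nat.log 2 N + 2
  have hn : N + 1 < 2 ^ n := by
    have := Nat.lt_pow_succ_log_self (b := 2) (by norm_num) N
    have h2 : 2 ^ n = 2 ^ (Nat.log 2 N).succ * 2 := by rw [← pow_succ]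
    omega
  have h1 := Separable.left (bilinearWeight A) (norm_bilinearWeight_le A)
  have h2 := Separable.indicator_mul_mod_four
  -- The minima only bound the functions by `2 ^ n`; they change nothing for `m, l ≤ N`.
  have h3 := Separable.indicator_lt n (fun m => min m.minFac N)
    (fun l => Nat.findGreatest (Sifted l) N + 1) (fun m => by omega)
    (fun l => by have := Nat.findGreatest_le (P := Sifted l) N; omega)
  have h4 := Separable.indicator_lt n (fun m => N / m) (fun l => min l (N + 1))
    (fun m => by have := Nat.div_le_self N m; omega) (fun l => by omega)
  have h5 := Separable.one.add (h4.smul (-1))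
  refine ⟨_, ((h1.mul (h2.mul (h3.mul h5)))).congr (fun _ _ => rfl) ?_, ?_⟩
  · simp; ring
  · intro m l hm hmN hl
    have hmf : m.minFac ≤ N := (Nat.minFac_le hm).trans hmN
    have e1 : (min m.minFac N < Nat.findGreatest (Sifted l) N + 1) ↔ Sifted l m.minFac := by
      rw [sifted_iff_le_findGreatest hmf, min_eq_left hmf, Nat.lt_succ_iff]
    have e2 : (N / m < min l (N + 1)) ↔ ¬ l ≤ N / m := by omega
    unfold bilinearKernel
    simp only [e1, e2]
    split_ifs <;> simp

/-- The bilinear sums: dyadic decomposition in `m`, then `sum_norm_bilinear_le`. -/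
lemma sum_norm_bilinearKernel_le {α β : ℝ} {a : ℤ} {q : ℕ} (hq : 1 ≤ q) (hcop : IsCoprime a (q : ℤ))
    (hα : α = (a : ℝ) / q + β) (hβ : (q : ℝ) ^ 2 * |β| ≤ 1) {A : ℝ} (hA : 0 < A) (N R : ℕ) {T : ℝ}
    (hT : ∀ k : ℕ, 1 ≤ k → k ≤ 2 * R * N → (#k.divisors : ℝ) ≤ T) (hT0 : 0 ≤ T) :
    ∑ r ∈ Icc 1 R, ‖∑ m ∈ Icc 1 N, ∑ l ∈ Icc 1 (N / m),
        bilinearKernel A m l * e ((r : ℝ) * m * l * α)‖ ≤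
      (Nat.log 2 N + 2 : ℕ) * (2 * ((Nat.log 2 N + 2 : ℕ) * ((Nat.log 2 N + 2 : ℕ) + 1)) *
        (T * √(24 * (R * N * (1 + Real.log q) * (R * N / q + N / A + R * A ^ 2 + q))))) := by
  obtain ⟨k, hk, hkeq⟩ := exists_separable_bilinearKernel A N
  set n := Nat.log 2 N + 2
  set V : ℝ := T * √(24 * (R * N * (1 + Real.log q) * (R * N / q + N / A + R * A ^ 2 + q))) with hV
  set P : Finset ℕ := {m ∈ Icc 1 N | A ≤ m ∧ (m : ℝ) ≤ A ^ 2} with hP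
  set s : ℕ → Finset ℕ := fun j => {m ∈ P | Nat.log 2 m = j} with hs
  have hq0 : (0 : ℝ) < q := by exact_mod_cast hq
  have hlog : 0 ≤ Real.log q := Real.log_nonneg (by exact_mod_cast hq)
  have hmem : ∀ j, ∀ m ∈ s j, 1 ≤ m ∧ m ≤ N ∧ A ≤ m ∧ (m : ℝ) ≤ A ^ 2 ∧ 2 ^ j ≤ m ∧ m < 2 * 2 ^ j := by
    intro j m hm
    simp only [hs, hP, mem_filter, mem_Icc] at hm
    obtain ⟨⟨⟨h1, h2⟩, h3, h4⟩, rfl⟩ := hm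
    refine ⟨h1, h2, h3, h4, Nat.pow_log_le_self 2 (by omega), ?_⟩
    have := Nat.lt_pow_succ_log_self (b := 2) (by norm_num) m
    rw [Nat.succ_eq_add_one, pow_succ] at this; omega
  have hsplit : ∀ r : ℕ, ∑ m ∈ Icc 1 N, ∑ l ∈ Icc 1 (N / m),
        bilinearKernel A m l * e ((r : ℝ) * m * l * α)
      = ∑ j ∈ range n, ∑ m ∈ s j, ∑ l ∈ Icc 1 (N / 2 ^ j), k m l * e ((r : ℝ) * m * l * α) := by
    intro r
    -- `bilinearWeight A m` vanishes unless `m ∈ [A, A ^ 2]`.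
    have h1 : ∑ m ∈ Icc 1 N, ∑ l ∈ Icc 1 (N / m), bilinearKernel A m l * e ((r : ℝ) * m * l * α)
        = ∑ m ∈ P, ∑ l ∈ Icc 1 (N / m), bilinearKernel A m l * e ((r : ℝ) * m * l * α) := by
      symm
      rw [hP]
      refine sum_filter_of_ne fun m _ hne => ?_
      by_contra hcon
      refine hne (sum_eq_zero fun l _ => ?_)
      have : bilinearWeight A m = 0 := if_neg fun h => hcon ⟨h.1, h.2.1⟩
      simp [bilinearKernel, this]
    have hmaps : ∀ m ∈ P, Nat.log 2 m ∈ range n := by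
      intro m hm
      rw [hP, mem_filter, mem_Icc] at hm
      rw [mem_range]
      have := Nat.log_mono_right (b := 2) hm.1.2
      omega
    rw [h1, ← sum_fiberwise_of_maps_to hmaps]
    refine sum_congr rfl fun j _ => sum_congr rfl fun m hm => ?_
    obtain ⟨h1, h2, -, -, h5, -⟩ := hmem j m hm
    have hsub : Icc 1 (N / m) ⊆ Icc 1 (N / 2 ^ j) :=
      Icc_subset_Icc_right (Nat.div_le_div_left h5 (by positivity))
    rw [← sum_subset hsub]
    · refine sum_congr rfl fun l hl => ?_
      rw [mem_Icc] at hl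
      rw [hkeq m l h1 h2 (hl.2.trans (Nat.div_le_self N m)), if_pos hl.2]
    · intro l hl hl'
      rw [mem_Icc] at hl hl'
      rw [hkeq m l h1 h2 (hl.2.trans (Nat.div_le_self N _)), if_neg (fun h => hl' ⟨hl.1, h⟩),
        zero_mul]
  have hK0 : (0 : ℝ) ≤ 2 * ((n : ℕ) * ((n : ℕ) + 1)) := by positivity
  have hj : ∀ j ∈ range n, ∑ r ∈ Icc 1 R, ‖∑ m ∈ s j, ∑ l ∈ Icc 1 (N / 2 ^ j),
      k m l * e ((r : ℝ) * m * l * α)‖ ≤ 2 * ((n : ℕ) * ((n : ℕ) + 1)) * V := by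
    intro j _
    refine hk.sum_norm_le α R (s j) (Icc 1 (N / 2 ^ j)) fun x y hx hy => ?_
    rcases (s j).eq_empty_or_nonempty with h0 | ⟨m₀, hm₀⟩
    · simp only [h0, sum_empty, norm_zero, sum_const_zero]
      positivity
    · obtain ⟨-, h2, h3, h4, h5, h6⟩ := hmem j m₀ hm₀
      have hb := sum_norm_bilinear_le hq hcop hα hβ R (2 * 2 ^ j) (N / 2 ^ j) (s j)
        (fun m hm => ⟨(hmem j m hm).1, (hmem j m hm).2.2.2.2.2.le⟩) (T := T)
        (fun k hk1 hk2 => hT k hk1 (hk2.trans (by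
          rw [mul_comm 2 R, mul_assoc]
          exact Nat.mul_le_mul_left R (Nat.mul_le_mul_left 2 (h5.trans h2))))) hT0 x y hx hy
      refine hb.trans ?_
      rw [hV]
      refine mul_le_mul_of_nonneg_left (Real.sqrt_le_sqrt ?_) hT0
      set H : ℝ := ((N / 2 ^ j : ℕ) : ℝ) with hH
      set Q : ℝ := (2 : ℝ) ^ j with hQ
      have hQ0 : 0 < Q := by positivity
      have hH0 : 0 ≤ H := Nat.cast_nonneg _
      have hHQ : H * Q ≤ N := by
        rw [hH, hQ]
        exact_mod_cast Nat.div_mul_le_self N (2 ^ j)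
      have hQA : Q ≤ A ^ 2 := by
        refine le_trans ?_ h4
        rw [hQ]; exact_mod_cast h5
      have hAQ : A ≤ 2 * Q := by
        refine h3.trans ?_
        rw [hQ]; exact_mod_cast h6.le
      have hHA : H ≤ 2 * (N / A) := by
        rw [← mul_div_assoc, le_div_iff₀ hA]
        nlinarith [mul_le_mul_of_nonneg_left hAQ hH0]
      have hR0 : (0 : ℝ) ≤ R := Nat.cast_nonneg R
      have hl1 : 1 ≤ 1 + Real.log q := by linarith
      set ℓ := 1 + Real.log q
      push_cast
      rw [← hQ]
      have i1 : (R : ℝ) * (2 * Q) * H ≤ 2 * (R * N) := by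
        nlinarith [mul_le_mul_of_nonneg_left hHQ hR0]
      have hN0 : (0 : ℝ) ≤ N := Nat.cast_nonneg N
      have i2 : (H / q + 1) * (R * (2 * Q) + q * ℓ) ≤
          2 * (ℓ * (R * N / q + N / A + R * A ^ 2 + q)) := by
        have e1 : (H / q + 1) * (R * (2 * Q) + q * ℓ)
            = (R * (2 * Q) * H) / q + H * ℓ + 2 * (R * Q) + q * ℓ := by field_simp; ring
        have j1 : (R * (2 * Q) * H) / q ≤ 2 * (ℓ * (R * N / q)) := by
          calc (R * (2 * Q) * H) / q ≤ (2 * (R * N)) / q := by gcongr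
            _ = 1 * (2 * (R * N / q)) := by ring
            _ ≤ ℓ * (2 * (R * N / q)) := by gcongr
            _ = _ := by ring
        have j2 : H * ℓ ≤ 2 * (ℓ * (N / A)) := by
          nlinarith [mul_le_mul_of_nonneg_right hHA (zero_le_one.trans hl1)]
        have j3 : 2 * (R * Q) ≤ 2 * (ℓ * (R * A ^ 2)) := by
          have : (R : ℝ) * Q ≤ R * A ^ 2 := by gcongr
          have h0 : (0 : ℝ) ≤ R * A ^ 2 := by positivity
          nlinarith
        have j4 : (q : ℝ) * ℓ ≤ 2 * (ℓ * q) := by nlinarith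
        rw [e1]; linarith
      calc R * (2 * Q) * (H * ((H / q + 1) * (6 * (R * (2 * Q) + q * ℓ))))
          = 6 * ((R * (2 * Q) * H) * ((H / q + 1) * (R * (2 * Q) + q * ℓ))) := by ring
        _ ≤ 6 * ((2 * (R * N)) * (2 * (ℓ * (R * N / q + N / A + R * A ^ 2 + q)))) := by gcongr
        _ = _ := by ring
  calc _ ≤ ∑ r ∈ Icc 1 R, ∑ j ∈ range n, ‖∑ m ∈ s j, ∑ l ∈ Icc 1 (N / 2 ^ j),
          k m l * e ((r : ℝ) * m * l * α)‖ := by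
        refine sum_le_sum fun r _ => ?_
        rw [hsplit r]
        exact norm_sum_le _ _
    _ = ∑ j ∈ range n, ∑ r ∈ Icc 1 R, ‖∑ m ∈ s j, ∑ l ∈ Icc 1 (N / 2 ^ j),
          k m l * e ((r : ℝ) * m * l * α)‖ := sum_comm
    _ ≤ ∑ j ∈ range n, 2 * ((n : ℕ) * ((n : ℕ) + 1)) * V := sum_le_sum hj
    _ = _ := by rw [sum_const, card_range, nsmul_eq_mul]

/-- The sieve identity `b_eq_sum_divisors` summed against an additive character. -/
lemma S_eq {A : ℝ} (hA : 1 < A) {X : ℝ} (hX : 0 ≤ X) (hXA : X ≤ A ^ 4) (r : ℕ) (α : ℝ) :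
    S ((r : ℝ) * α) X =
      ∑ d ∈ Icc 1 ⌊X⌋₊, (sieveWeight d * (if (d : ℝ) < A then 1 else 0)) * progressionSum α ⌊X⌋₊ r d
      + ∑ m ∈ Icc 1 ⌊X⌋₊, ∑ l ∈ Icc 1 (⌊X⌋₊ / m), bilinearKernel A m l * e ((r : ℝ) * m * l * α) := by
  classical
  have h1 : S ((r : ℝ) * α) X = ∑ n ∈ Icc 1 ⌊X⌋₊, ∑ d ∈ n.divisors,
      (fun d l : ℕ => if d * l % 4 = 1 then (sieveWeight d * (if (d : ℝ) < A then 1 else 0)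
        + bilinearWeight A d * (if Sifted l d.minFac then 1 else 0)) * e ((r : ℝ) * d * l * α) else 0)
        d (n / d) := by
    unfold S
    refine sum_congr rfl fun n hn => ?_
    rw [mem_Icc] at hn
    have hnd : ∀ d ∈ n.divisors, d * (n / d) = n := fun d hd =>
      Nat.mul_div_cancel' (Nat.dvd_of_mem_divisors hd)
    by_cases h4 : n % 4 = 1
    · have hnX : (n : ℝ) ≤ A ^ 4 := le_trans (Nat.cast_le.mpr hn.2) ((Nat.floor_le hX).trans hXA)
      rw [b_eq_sum_divisors hA hnX h4, sum_mul]
      refine sum_congr rfl fun d hd => ?_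
      have hdr : ((d : ℝ)) * ((n / d : ℕ) : ℝ) = n := by exact_mod_cast hnd d hd
      dsimp only
      rw [hnd d hd, if_pos h4, divisorTerm]
      congr 2
      rw [← hdr]; ring
    · have hb : b n = 0 := Set.indicator_of_notMem (fun h => h4 ((mem_B_iff n).mp h).1) _
      rw [hb, zero_mul]
      refine (sum_eq_zero fun d hd => ?_).symm
      dsimp only
      rw [hnd d hd, if_neg h4]
  rw [h1, sum_sum_divisors (fun d l : ℕ => if d * l % 4 = 1 then
    (sieveWeight d * (if (d : ℝ) < A then 1 else 0)
        + bilinearWeight A d * (if Sifted l d.minFac then 1 else 0)) * e ((r : ℝ) * d * l * α) else 0),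
    ← sum_add_distrib]
  refine sum_congr rfl fun d _ => ?_
  rw [progressionSum, mul_sum, ← sum_add_distrib]
  refine sum_congr rfl fun l _ => ?_
  unfold bilinearKernel
  split_ifs <;> ring

/-- The estimate with explicit logarithms and a bound `T` for the divisor function. -/
lemma sum_norm_S_le {α β : ℝ} {a : ℤ} {q : ℕ} (hq : 1 ≤ q) (hcop : IsCoprime a (q : ℤ))
    (hα : α = (a : ℝ) / q + β) (hβ : (q : ℝ) ^ 2 * |β| ≤ 1) {A X : ℝ} (hA : 1 < A) (hX : 0 ≤ X)
    (hXA : X ≤ A ^ 4) (R : ℕ) {T : ℝ}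
    (hT : ∀ k : ℕ, 1 ≤ k → (k : ℝ) ≤ 4 * R * X → (#k.divisors : ℝ) ≤ T) (hT0 : 0 ≤ T)
    (hAX : A ≤ X) :
    ∑ r ∈ Icc 1 R, ‖S ((r : ℝ) * α) X‖ ≤
      T * (6 * ((4 * R * A + q) * (3 + Real.log q))
        + 48 * (R * X / q * (1 + Real.log (4 * R * X + 1))))
      + (Nat.log 2 ⌊X⌋₊ + 2 : ℕ) * (2 * ((Nat.log 2 ⌊X⌋₊ + 2 : ℕ) * ((Nat.log 2 ⌊X⌋₊ + 2 : ℕ) + 1)) *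
        (T * √(24 * (R * X * (1 + Real.log q) * (R * X / q + X / A + R * A ^ 2 + q))))) := by
  have hA0 : 0 < A := by linarith
  have hN : ((⌊X⌋₊ : ℕ) : ℝ) ≤ X := Nat.floor_le hX
  have hD : ((⌊A⌋₊ : ℕ) : ℝ) ≤ A := Nat.floor_le hA0.le
  have hR0 : (0 : ℝ) ≤ R := Nat.cast_nonneg R
  have hq0 : (0 : ℝ) < q := by exact_mod_cast hq
  have hlog : 0 ≤ Real.log q := Real.log_nonneg (by exact_mod_cast hq)
  have hlin := sum_progressionSum_le hq hcop hα hβ ⌊X⌋₊ R ⌊A⌋₊ (T := T) (fun k h1 h2 => hT k h1 (by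
    have : (k : ℝ) ≤ 4 * R * ⌊A⌋₊ := by exact_mod_cast h2
    refine this.trans ?_
    gcongr
    exact hD.trans hAX)) hT0
  have hbil := sum_norm_bilinearKernel_le hq hcop hα hβ hA0 ⌊X⌋₊ R (T := T) (fun k h1 h2 => hT k h1 (by
    have : (k : ℝ) ≤ 2 * R * ⌊X⌋₊ := by exact_mod_cast h2
    refine this.trans ?_
    gcongr
    norm_num)) hT0
  have hterm : ∀ r ∈ Icc 1 R, ‖S ((r : ℝ) * α) X‖ ≤ ∑ d ∈ Icc 1 ⌊A⌋₊, ‖progressionSum α ⌊X⌋₊ r d‖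
      + ‖∑ m ∈ Icc 1 ⌊X⌋₊, ∑ l ∈ Icc 1 (⌊X⌋₊ / m), bilinearKernel A m l * e ((r : ℝ) * m * l * α)‖ := by
    intro r _
    rw [S_eq hA hX hXA]
    refine (norm_add_le _ _).trans (add_le_add_left ?_ _)
    have hsub : Icc 1 ⌊A⌋₊ ⊆ Icc 1 ⌊X⌋₊ := Icc_subset_Icc_right (Nat.floor_mono hAX)
    rw [← sum_subset hsub]
    · refine (norm_sum_le _ _).trans (sum_le_sum fun d _ => ?_)
      rw [norm_mul]
      refine mul_le_of_le_one_left (norm_nonneg _) ?_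
      rw [norm_mul]
      refine mul_le_one₀ (norm_sieveWeight_le d) (norm_nonneg _) ?_
      split_ifs <;> simp
    · intro d hd hd'
      rw [mem_Icc] at hd hd'
      have : ¬ (d : ℝ) < A := fun h => hd' ⟨hd.1, Nat.le_floor h.le⟩
      rw [if_neg this, mul_zero, zero_mul]
  refine (sum_le_sum hterm).trans ?_
  rw [sum_add_distrib]
  refine add_le_add (hlin.trans ?_) (hbil.trans ?_)
  · gcongr
    · have : 0 ≤ Real.log (4 * R * (⌊A⌋₊ : ℝ) + 1) :=
        Real.log_nonneg (le_add_of_nonneg_left (by positivity))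
      linarith
    · exact hD.trans hAX
  · gcongr

/-! ### Choice of the level -/

lemma norm_S_le {X : ℝ} (hX : 0 ≤ X) (θ : ℝ) : ‖S θ X‖ ≤ X := by
  unfold S
  refine (norm_sum_le _ _).trans ?_
  have h : ∀ n ∈ Icc 1 ⌊X⌋₊, ‖b n * e (n * θ)‖ ≤ 1 := by
    intro n _
    rw [norm_mul, norm_e, mul_one, b]
    by_cases hn : n ∈ B
    · rw [Set.indicator_of_mem hn]; simp
    · rw [Set.indicator_of_notMem hn]; simp
  refine (sum_le_sum h).trans ?_
  simpa using Nat.floor_le hX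

/-- The choice of the level: `A = max ((X / R) ^ (1 / 3), X ^ (1 / 4))`, written with `R = t ^ 3` and
`X = x ^ 12`, so that `A = max (x ^ 4 / t, x ^ 3)`. -/
lemma exists_level {t x : ℝ} (ht : 1 ≤ t) (hx : 1 < x) : ∃ A : ℝ, 1 < A ∧ A ≤ x ^ 12 ∧
    x ^ 12 ≤ A ^ 4 ∧ t ^ 3 * x ^ 6 * A ≤ t ^ 2 * x ^ 10 + t ^ 4 * x ^ 8 ∧
    t ^ 3 * x ^ 24 / A ≤ (t ^ 2 * x ^ 10) ^ 2 := by
  have ht0 : 0 < t := by linarith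
  have hx0 : 0 < x := by linarith
  refine ⟨max (x ^ 4 / t) (x ^ 3), lt_max_of_lt_right (one_lt_pow₀ hx (by norm_num)),
    max_le ?_ (pow_le_pow_right₀ hx.le (by norm_num)), ?_, ?_, ?_⟩
  · calc x ^ 4 / t ≤ x ^ 4 := div_le_self (by positivity) ht
      _ ≤ x ^ 12 := pow_le_pow_right₀ hx.le (by norm_num)
  · calc x ^ 12 = (x ^ 3) ^ 4 := by ring
      _ ≤ _ := by gcongr; exact le_max_right _ _
  · rcases le_total (x ^ 4 / t) (x ^ 3) with h | h
    · rw [max_eq_right h]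
      have h1 : x ≤ t := by
        rw [div_le_iff₀ ht0, show x ^ 4 = x ^ 3 * x by ring] at h
        exact le_of_mul_le_mul_left h (by positivity)
      have h2 : 0 ≤ t ^ 2 * x ^ 10 := by positivity
      have h3 : t ^ 3 * x ^ 6 * x ^ 3 ≤ t ^ 4 * x ^ 8 := by
        have : (t ^ 3 * x ^ 8) * x ≤ (t ^ 3 * x ^ 8) * t := by gcongr
        linarith
      linarith
    · rw [max_eq_left h]
      have h2 : 0 ≤ t ^ 4 * x ^ 8 := by positivity
      have h3 : t ^ 3 * x ^ 6 * (x ^ 4 / t) = t ^ 2 * x ^ 10 := by field_simp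
      linarith
  · calc t ^ 3 * x ^ 24 / max (x ^ 4 / t) (x ^ 3) ≤ t ^ 3 * x ^ 24 / (x ^ 4 / t) := by
          gcongr; exact le_max_left _ _
      _ = (t ^ 2 * x ^ 10) ^ 2 := by field_simp

/-- The four terms of the linear and bilinear bounds against the final bound. -/
lemma error_terms_le {R r X Y A q P Q : ℝ} (hR0 : 0 ≤ R) (hR : R ≤ r) (hY : 1 ≤ Y)
    (hX : X = Y * Y) (hA : 0 < A) (hq : 1 ≤ q) (hqr : q ≤ r * X) (hP : 0 ≤ P) (hQ : 0 ≤ Q)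
    (hA2 : r * Y * A ≤ P + Q) (hA3 : r * (X * X) / A ≤ P ^ 2) {U : ℝ}
    (hU : U = r * X / √q + √(q * (r * X)) + P + Q) :
    0 ≤ U ∧ 4 * R * A + q ≤ 5 * U ∧ R * X / q ≤ U ∧
      R * X * (R * X / q + X / A + R * A ^ 2 + q) ≤ 4 * U ^ 2 := by
  have hr0 : 0 ≤ r := hR0.trans hR
  have hY0 : 0 < Y := by linarith only [hY]
  have hX0 : 0 < X := hX ▸ mul_pos hY0 hY0
  have hq0 : 0 < q := by linarith only [hq]
  have u1 : 0 ≤ r * X / √q := by positivity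
  have u2 : 0 ≤ √(q * (r * X)) := Real.sqrt_nonneg _
  have hU0 : 0 ≤ U := by rw [hU]; positivity
  have hPU : P ≤ U := by linarith only [hU, u1, u2, hQ]
  have hPQU : P + Q ≤ U := by linarith only [hU, u1, u2]
  have hqU : √(q * (r * X)) ≤ U := by linarith only [hU, u1, hP, hQ]
  have hrU : r * X / √q ≤ U := by linarith only [hU, u2, hP, hQ]
  refine ⟨hU0, ?_, ?_, ?_⟩
  · have b1 : R * A ≤ U := by
      calc R * A ≤ r * A * 1 := by rw [mul_one]; gcongr
        _ ≤ r * A * Y := by gcongr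
        _ = r * Y * A := by ring
        _ ≤ U := hA2.trans hPQU
    have b2 : q ≤ U := by
      refine le_trans (Real.le_sqrt_of_sq_le ?_) hqU
      rw [sq]; gcongr
    linarith only [b1, b2]
  · refine le_trans ?_ hrU
    have h1 : √q ≤ q := Real.sqrt_le_iff.mpr ⟨hq0.le, le_self_pow₀ hq two_ne_zero⟩
    have h2 : 0 < √q := Real.sqrt_pos.mpr hq0
    gcongr
  · have c1 : R * X * (R * X / q) ≤ U ^ 2 := by
      calc R * X * (R * X / q) ≤ r * X * (r * X / q) := by gcongr
        _ = (r * X / √q) ^ 2 := by rw [div_pow, Real.sq_sqrt hq0.le]; ring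
        _ ≤ U ^ 2 := by gcongr
    have c2 : R * X * (X / A) ≤ U ^ 2 := by
      calc R * X * (X / A) ≤ r * X * (X / A) := by gcongr
        _ = r * (X * X) / A := by ring
        _ ≤ P ^ 2 := hA3
        _ ≤ U ^ 2 := by gcongr
    have c3 : R * X * (R * A ^ 2) ≤ U ^ 2 := by
      calc R * X * (R * A ^ 2) ≤ r * X * (r * A ^ 2) := by gcongr
        _ = (r * Y * A) ^ 2 := by rw [hX]; ring
        _ ≤ U ^ 2 := by
          have h0 : 0 ≤ r * Y * A := by positivity
          exact pow_le_pow_left₀ h0 (hA2.trans hPQU) 2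
    have c4 : R * X * q ≤ U ^ 2 := by
      calc R * X * q ≤ r * X * q := by gcongr
        _ = √(q * (r * X)) ^ 2 := by rw [Real.sq_sqrt (by positivity)]; ring
        _ ≤ U ^ 2 := by gcongr
    linarith only [c1, c2, c3, c4]

/-- Every logarithm in `sum_norm_S_le` is at most `L`. -/
lemma le_of_log_le {T L U n l₁ l₂ B C D : ℝ} (hT : 0 ≤ T) (hL : 1 ≤ L) (hU : 0 ≤ U) (hn : 0 ≤ n)
    (hnL : n + 1 ≤ L) (h₁ : 0 ≤ l₁) (h₁L : 2 + l₁ ≤ L) (h₂ : 0 ≤ l₂) (h₂L : l₂ ≤ L)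
    (hB : B ≤ 5 * U) (hC : C ≤ U) (hD : D ≤ 4 * U ^ 2) :
    T * (6 * (B * (2 + l₁)) + 48 * (C * l₂)) + n * (2 * (n * (n + 1)) * (T * √(24 * (l₁ * D)))) ≤
      98 * T * L ^ 4 * U := by
  have e1 : 6 * (B * (2 + l₁)) + 48 * (C * l₂) ≤ 78 * (L ^ 4 * U) := by
    have h3 : B * (2 + l₁) ≤ 5 * U * L := by gcongr
    have h4 : C * l₂ ≤ U * L := by gcongr
    have h5 : L * U ≤ L ^ 4 * U := by
      gcongr
      exact le_self_pow₀ hL (by norm_num)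
    linarith only [h3, h4, h5]
  have e2 : √(24 * (l₁ * D)) ≤ 10 * (L * U) := by
    refine Real.sqrt_le_iff.mpr ⟨by positivity, ?_⟩
    have h3 : l₁ * D ≤ L * (4 * U ^ 2) := by
      calc l₁ * D ≤ l₁ * (4 * U ^ 2) := by gcongr
        _ ≤ L * (4 * U ^ 2) := by gcongr; linarith only [h₁L]
    have h4 : L * U ^ 2 ≤ L * L * U ^ 2 := by
      gcongr; exact le_mul_of_one_le_left (by linarith only [hL]) hL
    have h5 : 0 ≤ L * L * U ^ 2 := by positivity
    calc 24 * (l₁ * D) ≤ 100 * (L * L * U ^ 2) := by linarith only [h3, h4, h5]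
      _ = _ := by ring
  have hnL' : n ≤ L := by linarith only [hnL]
  calc _ ≤ T * (78 * (L ^ 4 * U)) + L * (2 * (L * L) * (T * (10 * (L * U)))) := by gcongr
    _ = _ := by ring

lemma sum_norm_S_le_of_level {α β : ℝ} {a : ℤ} {q : ℕ} (hq : 1 ≤ q) (hcop : IsCoprime a (q : ℤ))
    (hα : α = (a : ℝ) / q + β) (hβ : (q : ℝ) ^ 2 * |β| ≤ 1) {t x : ℝ} (ht : 1 ≤ t) (hx : 1 < x)
    (htx : t ^ 3 ≤ x ^ 12) (hqtx : (q : ℝ) ≤ t ^ 3 * x ^ 12) (R : ℕ) (hR : (R : ℝ) ≤ t ^ 3) {T : ℝ}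
    (hT : ∀ k : ℕ, 1 ≤ k → (k : ℝ) ≤ 4 * (x ^ 12) ^ 2 → (#k.divisors : ℝ) ≤ T) (hT0 : 0 ≤ T) :
    ∑ r ∈ Icc 1 R, ‖S ((r : ℝ) * α) (x ^ 12)‖ ≤
      98 * T * (5 + 2 * Real.log (x ^ 12)) ^ 4 * (t ^ 3 * x ^ 12 / √q + √(q * (t ^ 3 * x ^ 12))
        + t ^ 2 * x ^ 10 + t ^ 4 * x ^ 8) := by
  obtain ⟨A, hA1, hAX, hXA, hA2, hA3⟩ := exists_level ht hx
  have hmain := sum_norm_S_le hq hcop hα hβ hA1 (X := x ^ 12) (by positivity) hXA R (T := T)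
    (fun k h1 h2 => hT k h1 (h2.trans (by
      rw [sq, mul_assoc]
      gcongr
      exact hR.trans htx))) hT0 hAX
  have hA0 : 0 < A := by linarith only [hA1]
  have hq0 : (0 : ℝ) < q := by exact_mod_cast hq
  have hq1 : (1 : ℝ) ≤ q := by exact_mod_cast hq
  have hx0 : 0 < x := by linarith only [hx]
  have hX1 : 1 ≤ x ^ 12 := one_le_pow₀ hx.le
  have hR0 : (0 : ℝ) ≤ R := Nat.cast_nonneg R
  have ht0 : 0 < t := by linarith only [ht]
  obtain ⟨hU0, hB, hC, hD⟩ := error_terms_le (U := _) hR0 hR (one_le_pow₀ hx.le : 1 ≤ x ^ 6)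
    (show x ^ 12 = x ^ 6 * x ^ 6 by ring) hA0 hq1 hqtx (by positivity) (by positivity) hA2
    (by rw [show x ^ 12 * x ^ 12 = x ^ 24 by ring]; exact hA3) rfl
  generalize x ^ 12 = X at *
  have hX0 : 0 < X := by linarith only [hX1]
  have hlogX : 0 ≤ Real.log X := Real.log_nonneg hX1
  have hlogq0 : 0 ≤ Real.log q := Real.log_nonneg hq1
  have hlogq : Real.log q ≤ 2 * Real.log X := by
    rw [show (2 : ℝ) * Real.log X = Real.log (X ^ 2) by rw [Real.log_pow]; push_cast; ring]
    refine Real.log_le_log hq0 (hqtx.trans ?_)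
    rw [sq]; gcongr
  have hlogR : 1 + Real.log (4 * R * X + 1) ≤ 5 + 2 * Real.log X := by
    have h0 : R * X ≤ X ^ 2 := by rw [sq]; gcongr; exact hR.trans htx
    have h00 : 1 ≤ X ^ 2 := one_le_pow₀ hX1
    have h1 : 4 * R * X + 1 ≤ 5 * X ^ 2 := by linarith only [h0, h00]
    have h2 : Real.log (4 * R * X + 1) ≤ Real.log (5 * X ^ 2) :=
      Real.log_le_log (by positivity) h1
    rw [Real.log_mul (by norm_num) (by positivity), Real.log_pow] at h2
    have h3 := Real.log_le_sub_one_of_pos (show (0 : ℝ) < 5 by norm_num)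
    push_cast at h2
    linarith only [h2, h3]
  have hlogR0 : 0 ≤ Real.log (4 * R * X + 1) := Real.log_nonneg (le_add_of_nonneg_left (by positivity))
  have hn : ((Nat.log 2 ⌊X⌋₊ + 2 : ℕ) : ℝ) + 1 ≤ 5 + 2 * Real.log X := by
    have h1 : (Nat.log 2 ⌊X⌋₊ : ℝ) ≤ Real.logb 2 ⌊X⌋₊ := Real.natLog_le_logb _ _
    have hfl : (1 : ℝ) ≤ ⌊X⌋₊ := by exact_mod_cast Nat.le_floor (by exact_mod_cast hX1)
    have h2 : Real.log ⌊X⌋₊ ≤ Real.log X :=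
      Real.log_le_log (by linarith only [hfl]) (Nat.floor_le hX0.le)
    have h3 : Real.logb 2 ⌊X⌋₊ ≤ 2 * Real.log X := by
      have hl := Real.log_two_gt_d9
      rw [Real.logb, div_le_iff₀ (by linarith only [hl])]
      nlinarith only [h2, hl, hlogX]
    push_cast; linarith only [h1, h3]
  have hfin := le_of_log_le (T := T) (L := 5 + 2 * Real.log X) (l₁ := 1 + Real.log q) hT0
    (by linarith only [hlogX]) hU0 (Nat.cast_nonneg (Nat.log 2 ⌊X⌋₊ + 2)) hn
    (by linarith only [hlogq0]) (by linarith only [hlogq]) (by linarith only [hlogR0]) hlogR hB hC hD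
  refine hmain.trans (le_trans (le_of_eq ?_) hfin)
  rw [show 3 + Real.log q = 2 + (1 + Real.log q) by ring,
    show ∀ E : ℝ, R * X * (1 + Real.log q) * E = (1 + Real.log q) * (R * X * E) from fun E => by ring]

/-! ### The final estimate -/

/-- The estimate with `R = t ^ 3` and `N = x ^ 12`, and `(5 + 2 * log N) ^ 4` in place of a power of
`N`. Outside the range `R ≤ N`, `q ≤ R N` it is trivial. -/
lemma exists_sum_norm_S_le (δ : ℝ) (hδ : 0 < δ) : ∃ C : ℝ, 0 < C ∧
    ∀ (α β : ℝ) (a : ℤ) (q : ℕ), 1 ≤ q → IsCoprime a (q : ℤ) → α = (a : ℝ) / (q : ℝ) + β →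
      (q : ℝ) ^ 2 * |β| ≤ 1 → ∀ t x : ℝ, 1 ≤ t → 1 < x → ∀ R : ℕ, (R : ℝ) ≤ t ^ 3 →
      ∑ r ∈ Icc 1 R, ‖S ((r : ℝ) * α) (x ^ 12)‖ ≤
        C * ((x ^ 12) ^ 2) ^ δ * (5 + 2 * Real.log (x ^ 12)) ^ 4 *
          (t ^ 3 * x ^ 12 / √q + √(q * (t ^ 3 * x ^ 12)) + t ^ 2 * x ^ 10 + t ^ 4 * x ^ 8) := by
  obtain ⟨C₀, hC₀, hdiv⟩ := exists_card_divisors_le δ hδ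
  have h4 : 1 ≤ (4 : ℝ) ^ δ := Real.one_le_rpow (by norm_num) hδ.le
  refine ⟨98 * (C₀ * 4 ^ δ), by positivity, ?_⟩
  intro α β a q hq hcop hα hβ t x ht hx R hR
  have hx0 : 0 < x := by linarith only [hx]
  have ht0 : 0 < t := by linarith only [ht]
  have hX1 : 1 ≤ x ^ 12 := one_le_pow₀ hx.le
  have hq0 : (0 : ℝ) < q := by exact_mod_cast hq
  by_cases hmain : t ^ 3 ≤ x ^ 12 ∧ (q : ℝ) ≤ t ^ 3 * x ^ 12
  · have hT : ∀ k : ℕ, 1 ≤ k → (k : ℝ) ≤ 4 * (x ^ 12) ^ 2 →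
        (#k.divisors : ℝ) ≤ C₀ * (4 * (x ^ 12) ^ 2) ^ δ := by
      intro k hk hkX
      refine (hdiv k (by omega)).trans ?_
      gcongr
    refine (sum_norm_S_le_of_level hq hcop hα hβ ht hx hmain.1 hmain.2 R hR hT (by positivity)).trans
      (le_of_eq ?_)
    rw [Real.mul_rpow (by norm_num) (by positivity)]
    ring
  · have htriv : ∑ r ∈ Icc 1 R, ‖S ((r : ℝ) * α) (x ^ 12)‖ ≤ t ^ 3 * x ^ 12 := by
      refine (sum_le_sum fun r _ => norm_S_le (by positivity) _).trans ?_
      rw [sum_const, Nat.card_Icc, nsmul_eq_mul]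
      simp only [add_tsub_cancel_right]
      gcongr
    set U : ℝ := t ^ 3 * x ^ 12 / √q + √(q * (t ^ 3 * x ^ 12)) + t ^ 2 * x ^ 10 + t ^ 4 * x ^ 8
    have u1 : 0 ≤ t ^ 3 * x ^ 12 / √q := by positivity
    have u2 : 0 ≤ √(q * (t ^ 3 * x ^ 12)) := Real.sqrt_nonneg _
    have u3 : 0 ≤ t ^ 2 * x ^ 10 := by positivity
    have u4 : 0 ≤ t ^ 4 * x ^ 8 := by positivity
    have hU : t ^ 3 * x ^ 12 ≤ U := by
      rw [not_and_or, not_le, not_le] at hmain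
      rcases hmain with h | h
      · have h1 : x ^ 4 ≤ t := by
          rw [show x ^ 12 = (x ^ 4) ^ 3 by ring] at h
          exact (lt_of_pow_lt_pow_left₀ 3 ht0.le h).le
        have h2 : t ^ 3 * x ^ 8 * x ^ 4 ≤ t ^ 3 * x ^ 8 * t := by gcongr
        linarith only [h2, u1, u2, u3]
      · have h1 : t ^ 3 * x ^ 12 ≤ √(q * (t ^ 3 * x ^ 12)) := by
          refine Real.le_sqrt_of_sq_le ?_
          rw [sq]; gcongr
        linarith only [h1, u1, u3, u4]
    have hlog : 0 ≤ Real.log (x ^ 12) := Real.log_nonneg hX1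
    have hc1 : 1 ≤ ((x ^ 12) ^ 2) ^ δ := Real.one_le_rpow (one_le_pow₀ hX1) hδ.le
    have hc2 : 1 ≤ (5 + 2 * Real.log (x ^ 12)) ^ 4 := one_le_pow₀ (by linarith only [hlog])
    have hc3 : 1 ≤ 98 * (C₀ * 4 ^ δ) := by
      have : 1 * 1 ≤ C₀ * 4 ^ δ := by gcongr
      linarith only [this]
    have hc : 1 ≤ 98 * (C₀ * 4 ^ δ) * ((x ^ 12) ^ 2) ^ δ * (5 + 2 * Real.log (x ^ 12)) ^ 4 :=
      one_le_mul_of_one_le_of_one_le (one_le_mul_of_one_le_of_one_le hc3 hc1) hc2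
    exact htriv.trans (hU.trans (le_mul_of_one_le_left (hU.trans' (by positivity)) hc))

lemma five_add_two_mul_log_le {δ X : ℝ} (hδ : 0 < δ) (hX : 1 ≤ X) :
    5 + 2 * Real.log X ≤ (5 + 2 / δ) * X ^ δ := by
  have h1 := Real.log_le_rpow_div (by linarith : 0 ≤ X) hδ
  have h2 : 1 ≤ X ^ δ := Real.one_le_rpow hX hδ.le
  have h3 : 2 / δ * X ^ δ = 2 * (X ^ δ / δ) := by ring
  rw [add_mul, h3]
  linarith only [h1, h2]

end OddPrimitive

theorem theorem8 (ε : ℝ) (hε : 0 < ε) :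
    ∃ C : ℝ, 0 < C ∧
      ∀ (α β : ℝ) (a : ℤ) (q : ℕ), 1 ≤ q → IsCoprime a (q : ℤ) →
        α = (a : ℝ) / (q : ℝ) + β → (q : ℝ) ^ 2 * |β| ≤ 1 →
        ∀ N R : ℝ, 1 < N → 1 ≤ R →
          ∑ r ∈ Finset.Icc 1 ⌊R⌋₊, ‖OddPrimitive.S ((r : ℝ) * α) N‖ ≤
            C * (R * N / √(Real.log N)) *
              (1 / √(q : ℝ) + √(q : ℝ) / √(R * N)
                + 1 / (R ^ (1 / 3 : ℝ) * N ^ (1 / 6 : ℝ))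
                + R ^ (1 / 3 : ℝ) / N ^ (1 / 3 : ℝ)) * N ^ ε := by
  -- Two powers `N ^ (ε / 7)` pay for the divisor function and five for the logarithms, including the
  -- `√(log N)` of the denominator.
  have hδ : 0 < ε / 7 := by positivity
  obtain ⟨C, hC, hmain⟩ := OddPrimitive.exists_sum_norm_S_le (ε / 7) hδ
  refine ⟨C * (5 + 2 / (ε / 7)) ^ 5, by positivity, ?_⟩
  intro α β a q hq hcop hα hβ N R hN hR
  have hN0 : 0 < N := by linarith only [hN]
  have hR0 : 0 < R := by linarith only [hR]
  have hq0 : (0 : ℝ) < q := by exact_mod_cast hq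
  have hlog : 0 < Real.log N := Real.log_pos hN
  obtain ⟨x, hx, hxN, hx6, hx3⟩ : ∃ x : ℝ, 1 < x ∧ x ^ 12 = N ∧ N ^ (1 / 6 : ℝ) = x ^ 2 ∧
      N ^ (1 / 3 : ℝ) = x ^ 4 := by
    refine ⟨N ^ (1 / 12 : ℝ), Real.one_lt_rpow hN (by norm_num), ?_, ?_, ?_⟩ <;>
    · rw [← Real.rpow_natCast, ← Real.rpow_mul hN0.le]; norm_num
  obtain ⟨t, ht, htR, ht3⟩ : ∃ t : ℝ, 1 ≤ t ∧ t ^ 3 = R ∧ R ^ (1 / 3 : ℝ) = t := by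
    refine ⟨R ^ (1 / 3 : ℝ), Real.one_le_rpow hR (by norm_num), ?_, rfl⟩
    rw [← Real.rpow_natCast, ← Real.rpow_mul hR0.le]; norm_num
  have ht0 : 0 < t := by linarith only [ht]
  have hx0 : 0 < x := by linarith only [hx]
  have h := hmain α β a q hq hcop hα hβ t x ht hx ⌊R⌋₊ (by rw [htR]; exact Nat.floor_le hR0.le)
  rw [hx6, hx3, ht3]
  set E : ℝ := 1 / √(q : ℝ) + √(q : ℝ) / √(R * N) + 1 / (t * x ^ 2) + t / x ^ 4 with hE
  have hE0 : 0 ≤ E := by positivity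
  have hU : t ^ 3 * x ^ 12 / √q + √(q * (t ^ 3 * x ^ 12)) + t ^ 2 * x ^ 10 + t ^ 4 * x ^ 8
      = R * N * E := by
    have e2 : √((q : ℝ) * (R * N)) = R * N * (√(q : ℝ) / √(R * N)) := by
      have hs : 0 < √(R * N) := Real.sqrt_pos.mpr (by positivity)
      rw [Real.sqrt_mul hq0.le, mul_div_assoc', eq_div_iff hs.ne', mul_assoc,
        Real.mul_self_sqrt (by positivity)]
      ring
    have e3 : t ^ 2 * x ^ 10 = R * N * (1 / (t * x ^ 2)) := by
      rw [← htR, ← hxN]; field_simp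
    have e4 : t ^ 4 * x ^ 8 = R * N * (t / x ^ 4) := by
      rw [← htR, ← hxN]; field_simp
    rw [htR, hxN, e2, e3, e4, hE]; ring
  rw [hU, hxN] at h
  have hL := OddPrimitive.five_add_two_mul_log_le hδ hN.le
  have hL0 : 0 < 5 + 2 * Real.log N := by linarith only [hlog]
  have hsq : √(Real.log N) ≤ 5 + 2 * Real.log N := by
    refine Real.sqrt_le_iff.mpr ⟨hL0.le, ?_⟩
    nlinarith only [hlog]
  have hs0 : 0 < √(Real.log N) := Real.sqrt_pos.mpr hlog
  have hpow : (N ^ 2) ^ (ε / 7) * (N ^ (ε / 7)) ^ 5 = N ^ ε := by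
    rw [← Real.rpow_natCast, ← Real.rpow_natCast, ← Real.rpow_mul hN0.le, ← Real.rpow_mul hN0.le,
      ← Real.rpow_add hN0]
    congr 1; push_cast; ring
  refine h.trans ?_
  rw [show ∀ c : ℝ, c * (R * N / √(Real.log N)) * E * N ^ ε
    = c * (R * N) * E * N ^ ε / √(Real.log N) from fun c => by ring, le_div_iff₀ hs0]
  calc C * (N ^ 2) ^ (ε / 7) * (5 + 2 * Real.log N) ^ 4 * (R * N * E) * √(Real.log N)
      ≤ C * (N ^ 2) ^ (ε / 7) * (5 + 2 * Real.log N) ^ 4 * (R * N * E) * (5 + 2 * Real.log N) := by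
        gcongr
    _ = C * (N ^ 2) ^ (ε / 7) * (R * N * E) * (5 + 2 * Real.log N) ^ 5 := by ring
    _ ≤ C * (N ^ 2) ^ (ε / 7) * (R * N * E) * ((5 + 2 / (ε / 7)) * N ^ (ε / 7)) ^ 5 := by gcongr
    _ = C * (5 + 2 / (ε / 7)) ^ 5 * (R * N) * E * ((N ^ 2) ^ (ε / 7) * (N ^ (ε / 7)) ^ 5) := by ring
    _ = _ := by rw [hpow]
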